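/- A rectilinear drawing of a finite simple graph $G$ places the vertices of $G$ at distinct points of the plane, no three of them collinear, and represents every edge by the straight segment joining its endpoints, in such a way that no three edges share an interior point. A crossing is a point that is interior to two distinct edges. For a rectilinear drawing $\mathcal D$ let $e_1(\mathcal D)$ be the number of edges that are part of exactly one crossing, and let $\overline{\max}\,e_1(K_n)$ be the maximum of $e_1(\mathcal D)$ over all rectilinear drawings $\mathcal D$ of the complete graph $K_n$ on $n$ vertices. Claim. For every integer $n\ge 8$ the maximum $\overline{\max}\,e_1(K_n)$ exists and $$\left\lceil\frac{3n}{2}\right\rceil-7\;\le\;\overline{\max}\,e_1(K_n)\;\le\;2n+\left\lfloor\frac{n-1}{2}\right\rfloor+7 .$$ -/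

import Mathlib

/-- The plane. -/
abbrev Plane : Type := EuclideanSpace ℝ (Fin 2)

/-- The interior of the straight edge `e` when its endpoints are placed by `p`:
the open segment between the images of the two endpoints. -/
def edgeInterior {V : Type*} (p : V → Plane) : Sym2 V → Set Plane :=
  Sym2.lift ⟨fun u v => openSegment ℝ (p u) (p v), fun u v => openSegment_symm ℝ (p u) (p v)⟩

/-- A rectilinear drawing of a graph `G`: the vertices are distinct points of the plane in general
position, every edge is the segment between its endpoints, and no three edges share an interior
point. (General position implies that no edge goes through a vertex other than its endpoints, that
two edges share at most one point, and that they are never tangent.) -/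
structure RectilinearDrawing {V : Type*} (G : SimpleGraph V) where
  /-- the position of each vertex -/
  pos : V → Plane
  pos_injective : Function.Injective pos
  general_position : ∀ u v w : V, u ≠ v → u ≠ w → v ≠ w →
    ¬ Collinear ℝ ({pos u, pos v, pos w} : Set Plane)
  no_three_edges : ∀ e ∈ G.edgeSet, ∀ f ∈ G.edgeSet, ∀ g ∈ G.edgeSet, e ≠ f → e ≠ g → f ≠ g →
    edgeInterior pos e ∩ edgeInterior pos f ∩ edgeInterior pos g = ∅

namespace RectilinearDrawing

variable {V : Type*} {G : SimpleGraph V}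

/-- The crossings that the edge `e` is part of: the interior points of `e` that are also interior
points of another edge of the drawing. -/
def crossingsOn (D : RectilinearDrawing G) (e : Sym2 V) : Set Plane :=
  {x | x ∈ edgeInterior D.pos e ∧ ∃ f ∈ G.edgeSet, f ≠ e ∧ x ∈ edgeInterior D.pos f}

/-- The `k`-crossing set: the edges of `G` that are part of exactly `k` crossings. -/
def crossingSet (D : RectilinearDrawing G) (k : ℕ) : Set (Sym2 V) :=
  {e | e ∈ G.edgeSet ∧ (D.crossingsOn e).encard = k}

/-- The `k`-crossing index `e_k(D)`: the number of edges that are part of exactly `k` crossings. -/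
noncomputable def crossingIndex (D : RectilinearDrawing G) (k : ℕ) : ℕ :=
  (D.crossingSet k).ncard

end RectilinearDrawing

/-- The set of values attained by `e_k` over all rectilinear drawings of `G`. -/
def rectilinearCrossingIndices {V : Type*} (G : SimpleGraph V) (k : ℕ) : Set ℕ :=
  {m | ∃ D : RectilinearDrawing G, D.crossingIndex k = m}

/-- The maximum of `e_k` over all rectilinear drawings of `G`. -/
noncomputable def maxRectilinearCrossingIndex {V : Type*} (G : SimpleGraph V) (k : ℕ) : ℕ :=
  sSup (rectilinearCrossingIndices G k)

/-! Upper bound. Take an extreme vertex as hub and number the other N = n − 1 vertices by angle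
around it. Edges at the hub are spokes, all others are arcs. Crossings are determined by the signs
telling whether j lies beyond ik as seen from the hub, and Grassmann–Plücker relations with the hub
show that the four signs of a quadruple change at most once. The second geometric input is
`GenPos.crosser_injective`: if cd were the only crosser of two edges, one of them would cross cd
into the triangle spanned by cd and an end of the other, and would have to leave through a second
side. `SpokeSystem` records these facts; the remaining argument is combinatorial.

The edges crossed once are spokes, arcs crossed by a spoke (necessarily (k − 1, k + 1) crossed by k,
a peak), and arcs crossed by an arc (top arcs). Neither once-crossed spokes nor peaks can be
consecutive, so after discarding the non-peak once-crossed spokes beside a peak, the remaining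
once-crossed spokes and peaks occupy at most (N + 1)/2 indices. Each discarded spoke, up to six near
the ends, and each index that is both a peak and a once-crossed spoke is paid for by a nearby short
arc that is not a top arc.

Two interlacing top arcs are each other's only crossers. Replacing the right one by the uncrossed
arc that spans both yields a family without interlacing, to which the missing short arcs can still
be added. Such a family has at most 2(N − 1) members (`card_topArcs_add_le`). The sum is 2n + ⌊n/2⌋
+ 2, which is below the claimed bound.

Lower bound. In `FourPattern`, integer points near a parabola come in blocks of four below a distant
hub, and each full block contributes six once-crossed edges. A small perturbation removes triple
points without changing any orientation, hence without changing which edges cross. -/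

/-! ### Orientations and crossing segments in the plane. -/

/-- Twice the signed area of the triangle `a b c`. -/
def orient (a b c : Plane) : ℝ := (b 0 - a 0) * (c 1 - a 1) - (c 0 - a 0) * (b 1 - a 1)

lemma orient_rotate (a b c : Plane) : orient b c a = orient a b c := by
  unfold orient; ring

lemma orient_swap (a b c : Plane) : orient a c b = -orient a b c := by
  unfold orient; ring

lemma orient_swap' (a b c : Plane) : orient b a c = -orient a b c := by
  unfold orient; ring

lemma plane_ext {a b : Plane} (h0 : a 0 = b 0) (h1 : a 1 = b 1) : a = b := by
  ext i; fin_cases i <;> simpa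

lemma collinear_iff_orient (a b c : Plane) :
    Collinear ℝ ({a, b, c} : Set Plane) ↔ orient a b c = 0 := by
  rw [collinear_iff_of_mem (p₀ := a) (by simp)]
  constructor
  · rintro ⟨v, hv⟩
    obtain ⟨r, hr⟩ := hv b (by simp)
    obtain ⟨t, ht⟩ := hv c (by simp)
    simp only [orient, hr, ht, vadd_eq_add, PiLp.add_apply, PiLp.smul_apply, smul_eq_mul]
    ring
  · intro h
    by_cases hab : a = b
    · refine ⟨c - a, ?_⟩
      rintro p (rfl | rfl | rfl)
      · exact ⟨0, by simp⟩
      · exact ⟨0, by simp [hab]⟩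
      · exact ⟨1, by simp⟩
    · refine ⟨b - a, ?_⟩
      have hne : b 0 - a 0 ≠ 0 ∨ b 1 - a 1 ≠ 0 := by
        by_contra hcon
        push Not at hcon
        exact hab (plane_ext (by linarith [hcon.1]) (by linarith [hcon.2]))
      unfold orient at h
      rintro p (rfl | rfl | rfl)
      · exact ⟨0, by simp⟩
      · exact ⟨1, by simp⟩
      · rcases hne with hne | hne
        · refine ⟨(p 0 - a 0) / (b 0 - a 0), plane_ext ?_ ?_⟩ <;>
            simp only [vadd_eq_add, PiLp.add_apply, PiLp.smul_apply, smul_eq_mul, PiLp.sub_apply] <;>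
            field_simp <;> linarith
        · refine ⟨(p 1 - a 1) / (b 1 - a 1), plane_ext ?_ ?_⟩ <;>
            simp only [vadd_eq_add, PiLp.add_apply, PiLp.smul_apply, smul_eq_mul, PiLp.sub_apply] <;>
            field_simp <;> linarith

lemma mem_openSegment_iff {a b x : Plane} :
    x ∈ openSegment ℝ a b ↔ ∃ t : ℝ, 0 < t ∧ t < 1 ∧
      x 0 = a 0 + t * (b 0 - a 0) ∧ x 1 = a 1 + t * (b 1 - a 1) := by
  constructor
  · rintro ⟨r, t, hr, ht, hrt, rfl⟩
    obtain rfl : r = 1 - t := by linarith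
    refine ⟨t, ht, by linarith, ?_, ?_⟩ <;>
      simp only [PiLp.add_apply, PiLp.smul_apply, smul_eq_mul] <;> ring
  · rintro ⟨t, h0, h1, hx, hy⟩
    refine ⟨1 - t, t, by linarith, h0, by ring, plane_ext ?_ ?_⟩ <;>
      simp only [PiLp.add_apply, PiLp.smul_apply, smul_eq_mul, hx, hy] <;> ring

/-- `orient a b` is affine along cd, so it vanishes at an interior point exactly when its end values
have opposite signs; likewise `orient c d` along ab. The hypothesis excludes collinear segments. -/
lemma openSegment_inter_nonempty_iff {a b c d : Plane} (hc : orient a b c ≠ 0) :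
    (openSegment ℝ a b ∩ openSegment ℝ c d).Nonempty ↔
      orient a b c * orient a b d < 0 ∧ orient c d a * orient c d b < 0 := by
  constructor
  · rintro ⟨x, h1, h2⟩
    obtain ⟨t, t0, t1, hx, hy⟩ := mem_openSegment_iff.1 h1
    obtain ⟨u, u0, u1, hx', hy'⟩ := mem_openSegment_iff.1 h2
    have e1 : (1 - u) * orient a b c + u * orient a b d = 0 := by
      have : (b 0 - a 0) * (x 1 - a 1) - (x 0 - a 0) * (b 1 - a 1) = 0 := by rw [hx, hy]; ring
      rw [hx', hy'] at this
      unfold orient; linear_combination this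
    have e2 : (1 - t) * orient c d a + t * orient c d b = 0 := by
      have : (d 0 - c 0) * (x 1 - c 1) - (x 0 - c 0) * (d 1 - c 1) = 0 := by rw [hx', hy']; ring
      rw [hx, hy] at this
      unfold orient; linear_combination this
    have e3 : orient c d b - orient c d a = orient a b c - orient a b d := by
      unfold orient; ring
    have k1 : orient a b c * orient a b d < 0 := by
      have : u * (orient a b c * orient a b d) = -((1 - u) * (orient a b c) ^ 2) := by
        linear_combination orient a b c * e1
      have hpos : 0 < (1 - u) * (orient a b c) ^ 2 := mul_pos (by linarith) (by positivity)
      by_contra hcon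
      push Not at hcon
      nlinarith [mul_nonneg u0.le hcon]
    have hne : orient c d a ≠ 0 := by
      intro h0
      rw [h0, mul_zero, zero_add] at e2
      have : orient c d b = 0 := by
        rcases mul_eq_zero.1 e2 with h | h
        · linarith
        · exact h
      have e4 : orient a b c = orient a b d := by linarith
      rw [← e4] at k1
      nlinarith [sq_nonneg (orient a b c)]
    refine ⟨k1, ?_⟩
    have : t * (orient c d a * orient c d b) = -((1 - t) * (orient c d a) ^ 2) := by
      linear_combination orient c d a * e2
    have hpos : 0 < (1 - t) * (orient c d a) ^ 2 := mul_pos (by linarith) (by positivity)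
    by_contra hcon
    push Not at hcon
    nlinarith [mul_nonneg t0.le hcon]
  · rintro ⟨h1, h2⟩
    have key : ∀ x y : ℝ, x * y < 0 → x - y ≠ 0 ∧ 0 < x / (x - y) ∧ x / (x - y) < 1 := by
      intro x y h
      rcases mul_neg_iff.1 h with ⟨hx, hy⟩ | ⟨hx, hy⟩
      · refine ⟨by linarith, by apply div_pos <;> linarith, ?_⟩
        rw [div_lt_one] <;> linarith
      · refine ⟨by linarith, by apply div_pos_of_neg_of_neg <;> linarith, ?_⟩
        rw [div_lt_one_of_neg] <;> linarith
    obtain ⟨n1, u0, u1⟩ := key _ _ h1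
    obtain ⟨n2, t0, t1⟩ := key _ _ h2
    -- The zero of `orient a b` on cd has parameter u, and the zero of `orient c d` on ab has
    -- parameter t; both are the crossing point.
    set u := orient a b c / (orient a b c - orient a b d) with hu
    set t := orient c d a / (orient c d a - orient c d b) with ht
    have hu' : u * (orient a b c - orient a b d) = orient a b c := by rw [hu]; field_simp
    have ht' : t * (orient c d a - orient c d b) = orient c d a := by rw [ht]; field_simp
    have e3 : orient c d b - orient c d a = orient a b c - orient a b d := by
      unfold orient; ring
    refine ⟨!₂[a 0 + t * (b 0 - a 0), a 1 + t * (b 1 - a 1)], ?_, ?_⟩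
    · exact mem_openSegment_iff.2 ⟨t, t0, t1, by simp, by simp⟩
    · refine mem_openSegment_iff.2 ⟨u, u0, u1, ?_, ?_⟩
      · simp only [Matrix.cons_val_zero]
        apply mul_left_cancel₀ n1
        unfold orient at *
        linear_combination (-(b 0 - a 0)) * ht' - (d 0 - c 0) * hu'
      · simp only [Matrix.cons_val_one, Matrix.cons_val_fin_one]
        apply mul_left_cancel₀ n1
        unfold orient at *
        linear_combination (-(b 1 - a 1)) * ht' - (d 1 - c 1) * hu'

lemma openSegment_inter_subsingleton {a b c d : Plane} (hc : orient a b c ≠ 0) :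
    (openSegment ℝ a b ∩ openSegment ℝ c d).Subsingleton := by
  rintro x ⟨h1, h2⟩ y ⟨h3, h4⟩
  obtain ⟨t, -, -, hx, hy⟩ := mem_openSegment_iff.1 h1
  obtain ⟨u, -, u1, hx', hy'⟩ := mem_openSegment_iff.1 h2
  obtain ⟨t', -, -, hz, hw⟩ := mem_openSegment_iff.1 h3
  obtain ⟨u', -, -, hz', hw'⟩ := mem_openSegment_iff.1 h4
  have e1 : (1 - u) * orient a b c + u * orient a b d = 0 := by
    have : (b 0 - a 0) * (x 1 - a 1) - (x 0 - a 0) * (b 1 - a 1) = 0 := by rw [hx, hy]; ring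
    rw [hx', hy'] at this
    unfold orient; linear_combination this
  have e2 : (1 - u') * orient a b c + u' * orient a b d = 0 := by
    have : (b 0 - a 0) * (y 1 - a 1) - (y 0 - a 0) * (b 1 - a 1) = 0 := by rw [hz, hw]; ring
    rw [hz', hw'] at this
    unfold orient; linear_combination this
  have e3 : u = u' := by
    have h : (u - u') * orient a b c = 0 := by linear_combination u * e2 - u' * e1
    rcases mul_eq_zero.1 h with h | h
    · linarith
    · exact absurd h hc
  apply plane_ext <;> simp only [hx', hy', hz', hw', e3]

lemma openSegment_inter_of_common {a b c : Plane} (hc : orient a b c ≠ 0) :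
    openSegment ℝ a b ∩ openSegment ℝ a c = ∅ := by
  rw [Set.eq_empty_iff_forall_notMem]
  rintro x ⟨h1, h2⟩
  obtain ⟨t, t0, -, hx, hy⟩ := mem_openSegment_iff.1 h1
  obtain ⟨u, u0, -, hx', hy'⟩ := mem_openSegment_iff.1 h2
  have : u * orient a b c = 0 := by
    have h : (b 0 - a 0) * (x 1 - a 1) - (x 0 - a 0) * (b 1 - a 1) = 0 := by rw [hx, hy]; ring
    rw [hx', hy'] at h
    unfold orient; linear_combination h
  rcases mul_eq_zero.1 this with h | h
  · linarith
  · exact hc h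

/-- The segments `ab` and `cd` cross, expressed by orientations. -/
def SegCross (a b c d : Plane) : Prop :=
  orient a b c * orient a b d < 0 ∧ orient c d a * orient c d b < 0

lemma segCross_symm {a b c d : Plane} : SegCross a b c d ↔ SegCross c d a b := And.comm

lemma segCross_swap_left {a b c d : Plane} : SegCross a b c d ↔ SegCross b a c d := by
  unfold SegCross
  rw [orient_swap' a b c, orient_swap' a b d, neg_mul_neg, mul_comm (orient c d a)]

lemma segCross_swap_right {a b c d : Plane} : SegCross a b c d ↔ SegCross a b d c := by
  rw [segCross_symm, segCross_swap_left, segCross_symm]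

/-! ### Four points seen from a hub. -/

/-- The truth values of `p, q, r, t` change at most once along the list. -/
def Mono4 (p q r t : Prop) : Prop :=
  (p → r → q) ∧ (¬p → ¬r → ¬q) ∧ (q → t → r) ∧ (¬q → ¬t → ¬r) ∧ (p → t → q) ∧ (¬p → ¬t → ¬q)

/-- The orientations of the four triples of `a, b, c, d`, in lexicographic order, change sign at
most once. -/
def SignMono (a b c d : Plane) : Prop :=
  Mono4 (0 < orient a b c) (0 < orient a b d) (0 < orient a c d) (0 < orient b c d)

/-- The identities are Grassmann–Plücker relations: each writes an inner term of the sign list as a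
combination, with positive weights supplied by the hub, of one term before it and one after it. -/
lemma signMono_of_hub {p a b c d : Plane} (hab : 0 < orient p a b) (hac : 0 < orient p a c)
    (had : 0 < orient p a d) (hbc : 0 < orient p b c) (hbd : 0 < orient p b d)
    (hcd : 0 < orient p c d) : SignMono a b c d := by
  have i1 : orient p a d * orient a b c + orient p a b * orient a c d
      = orient p a c * orient a b d := by unfold orient; ring
  have i2 : orient p a d * orient b c d + orient p c d * orient a b d
      = orient p b d * orient a c d := by unfold orient; ring
  have i3 : orient p a b * orient b c d + orient p b d * orient a b c
      = orient p b c * orient a b d := by unfold orient; ring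
  unfold SignMono Mono4
  simp only [not_lt]
  refine ⟨fun h1 h2 => ?_, fun h1 h2 => ?_, fun h1 h2 => ?_, fun h1 h2 => ?_, fun h1 h2 => ?_,
    fun h1 h2 => ?_⟩
  · exact pos_of_mul_pos_right (i1 ▸ by positivity) hac.le
  · by_contra hc
    push Not at hc
    nlinarith [mul_pos hac hc, mul_nonneg had.le (neg_nonneg.2 h1),
      mul_nonneg hab.le (neg_nonneg.2 h2)]
  · exact pos_of_mul_pos_right (i2 ▸ by positivity) hbd.le
  · by_contra hc
    push Not at hc
    nlinarith [mul_pos hbd hc, mul_nonneg had.le (neg_nonneg.2 h2),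
      mul_nonneg hcd.le (neg_nonneg.2 h1)]
  · exact pos_of_mul_pos_right (i3 ▸ by positivity) hbc.le
  · by_contra hc
    push Not at hc
    nlinarith [mul_pos hbc hc, mul_nonneg hab.le (neg_nonneg.2 h2),
      mul_nonneg hbd.le (neg_nonneg.2 h1)]

lemma mul_neg_iff_pos_iff {x y : ℝ} (hx : x ≠ 0) (hy : y ≠ 0) : x * y < 0 ↔ (0 < x ↔ ¬ 0 < y) := by
  rw [mul_neg_iff]
  rcases lt_or_gt_of_ne hx with h | h <;> rcases lt_or_gt_of_ne hy with h' | h' <;>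
    simp [h, h', h.not_gt, h'.not_gt]

section Criteria

variable {a b c d : Plane}

/-- A crossing requires two separation conditions. With at most one sign change a single comparison
decides both for interlacing or nested pairs, and for separated pairs the two conditions would need
two changes. -/
lemma Mono4.alternate {p q r t : Prop} (h : Mono4 p q r t) :
    (¬p ↔ ¬r) ∧ (¬q ↔ ¬t) ↔ (p ↔ t) := by
  unfold Mono4 at h
  by_cases p <;> by_cases q <;> by_cases r <;> by_cases t <;> simp_all

lemma Mono4.nested {p q r t : Prop} (h : Mono4 p q r t) :
    (q ↔ ¬r) ∧ (p ↔ ¬t) ↔ ¬(q ↔ r) := by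
  unfold Mono4 at h
  by_cases p <;> by_cases q <;> by_cases r <;> by_cases t <;> simp_all

lemma Mono4.separated {p q r t : Prop} (h : Mono4 p q r t) : ¬((p ↔ ¬q) ∧ (r ↔ ¬t)) := by
  unfold Mono4 at h
  by_cases p <;> by_cases q <;> by_cases r <;> by_cases t <;> simp_all

lemma segCross_iff_alternate (h1 : orient a b c ≠ 0) (h2 : orient a b d ≠ 0)
    (h3 : orient a c d ≠ 0) (h4 : orient b c d ≠ 0) (hm : SignMono a b c d) :
    SegCross a c b d ↔ (0 < orient a b c ↔ 0 < orient b c d) := by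
  unfold SegCross
  have e1 : orient a c b * orient a c d = -(orient a b c * orient a c d) := by unfold orient; ring
  have e2 : orient b d a * orient b d c = -(orient a b d * orient b c d) := by unfold orient; ring
  rw [e1, e2, ← neg_mul, ← neg_mul, mul_neg_iff_pos_iff (neg_ne_zero.2 h1) h3,
    mul_neg_iff_pos_iff (neg_ne_zero.2 h2) h4]
  have n1 : 0 < -orient a b c ↔ ¬ 0 < orient a b c := by
    rcases lt_or_gt_of_ne h1 with h | h <;> simp [h, h.not_gt]
  have n2 : 0 < -orient a b d ↔ ¬ 0 < orient a b d := by
    rcases lt_or_gt_of_ne h2 with h | h <;> simp [h, h.not_gt]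
  rw [n1, n2]
  exact hm.alternate

lemma segCross_iff_nested (h1 : orient a b c ≠ 0) (h2 : orient a b d ≠ 0)
    (h3 : orient a c d ≠ 0) (h4 : orient b c d ≠ 0) (hm : SignMono a b c d) :
    SegCross a d b c ↔ ¬ (0 < orient a b d ↔ 0 < orient a c d) := by
  unfold SegCross
  have e1 : orient a d b * orient a d c = orient a b d * orient a c d := by unfold orient; ring
  have e2 : orient b c a * orient b c d = orient a b c * orient b c d := by unfold orient; ring
  rw [e1, e2, mul_neg_iff_pos_iff h2 h3, mul_neg_iff_pos_iff h1 h4]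
  exact hm.nested

lemma not_segCross_of_separated (h1 : orient a b c ≠ 0) (h2 : orient a b d ≠ 0)
    (h3 : orient a c d ≠ 0) (h4 : orient b c d ≠ 0) (hm : SignMono a b c d) :
    ¬ SegCross a b c d := by
  unfold SegCross
  have e2 : orient c d a * orient c d b = orient a c d * orient b c d := by unfold orient; ring
  rw [e2, mul_neg_iff_pos_iff h1 h2, mul_neg_iff_pos_iff h3 h4]
  exact hm.separated

end Criteria

/-- This covers quadruples whose first point is the hub itself: only the last sign can differ. -/
lemma signMono_of_pos {a b c d : Plane} (h1 : 0 < orient a b c) (h2 : 0 < orient a b d)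
    (h3 : 0 < orient a c d) : SignMono a b c d := by
  unfold SignMono Mono4
  tauto

/-! ### Uniqueness of the edge with a given only crosser. -/

/-- Points in general position, in terms of `orient`. -/
def GenPos {V : Type*} (P : V → Plane) : Prop :=
  ∀ u v w : V, u ≠ v → u ≠ w → v ≠ w → orient (P u) (P v) (P w) ≠ 0

/-- Seen from `c`, the point `a'` lies strictly between `d` and the end `a` of a segment `ab` that
crosses `cd`. Then `ab` crosses `ca'` or `a'd`. -/
lemma segCross_of_between {c d a b a' : Plane} (hx : SegCross a b c d)
    (ha : 0 < orient c d a) (ha' : 0 < orient c d a') (haa : 0 < orient c a' a)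
    (n1 : orient b d a' ≠ 0) (n2 : orient b a' a ≠ 0) (n3 : orient d a' a ≠ 0) :
    SegCross a b c a' ∨ SegCross a b a' d := by
  by_contra hcon
  push Not at hcon
  obtain ⟨hn1, hn2⟩ := hcon
  have hb : 0 < orient c b d := by
    have := neg_of_mul_neg_right hx.2 ha.le
    rw [orient_swap]; linarith
  have e : orient a b c * orient a b d
      = orient c b a * (orient c b a - orient c b d - orient c d a) := by unfold orient; ring
  -- With W = `orient c b a`, the product is W times W minus two positive terms, so it is negative
  -- only for positive W. Thus b, d, a', a are in angular order around c.
  have hW : 0 < orient c b a := by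
    have h := hx.1
    rw [e] at h
    by_contra hc
    push Not at hc
    nlinarith [mul_nonneg (neg_nonneg.2 hc) (add_pos hb ha).le, sq_nonneg (orient c b a)]
  have hbda : 0 < orient b d a := by
    have h := neg_of_mul_neg_right (e ▸ hx.1) hW.le
    have e3 : orient b d a = -(orient c b a - orient c b d - orient c d a) := by
      unfold orient; ring
    linarith
  have hba' : 0 < orient c b a' := by
    have i : orient c b a' * orient c d a = orient c b d * orient c a' a
        + orient c b a * orient c d a' := by unfold orient; ring
    exact pos_of_mul_pos_left (i ▸ by positivity) ha.le
  have m1 : SignMono b d a' a := signMono_of_hub hb hba' hW ha' ha haa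
  -- If a' lies beyond ba as seen from c, then ca' crosses ba. Otherwise d and a' are on opposite
  -- sides of ba, and da' crosses it.
  have x3 : ¬ 0 < orient b a' a := by
    intro h
    apply hn1
    rw [segCross_symm, segCross_swap_right]
    rw [segCross_iff_alternate hba'.ne' hW.ne' haa.ne' h.ne' (signMono_of_pos hba' hW haa)]
    tauto
  apply hn2
  rw [segCross_swap_left, segCross_swap_right]
  rw [segCross_iff_nested n1 hbda.ne' n2 n3 m1]
  tauto

lemma GenPos.ne_of_segCross {V : Type*} {P : V → Plane} {a b c d : V}
    (h : SegCross (P a) (P b) (P c) (P d)) : a ≠ b ∧ c ≠ d ∧ a ≠ c ∧ a ≠ d ∧ b ≠ c ∧ b ≠ d := by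
  obtain ⟨h1, h2⟩ := h
  refine ⟨?_, ?_, ?_, ?_, ?_, ?_⟩ <;> rintro rfl <;> simp [orient] at h1 h2

lemma GenPos.left_end_unique {V : Type*} {P : V → Plane} (hP : GenPos P) {a b a' b' c d : V}
    (h : SegCross (P a) (P b) (P c) (P d))
    (hu : ∀ x y, SegCross (P a) (P b) (P x) (P y) → s(x, y) = s(c, d))
    (h' : SegCross (P a') (P b') (P c) (P d))
    (hu' : ∀ x y, SegCross (P a') (P b') (P x) (P y) → s(x, y) = s(c, d))
    (ha : 0 < orient (P c) (P d) (P a)) (ha' : 0 < orient (P c) (P d) (P a')) : a = a' := by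
  -- If a' precedes a when turning around c from d, then a is outside the triangle c, a', d, so ab
  -- needs a second side of the triangle and has a second crosser.
  have key : ∀ {a b a' b' : V}, SegCross (P a) (P b) (P c) (P d) →
      (∀ x y, SegCross (P a) (P b) (P x) (P y) → s(x, y) = s(c, d)) →
      SegCross (P a') (P b') (P c) (P d) →
      0 < orient (P c) (P d) (P a) → 0 < orient (P c) (P d) (P a') →
      0 < orient (P c) (P a') (P a) → False := by
    intro a b a' b' h hu h' ha ha' haa
    obtain ⟨-, hcd, hac, had, hbc, hbd⟩ := ne_of_segCross h
    obtain ⟨-, -, hac', had', -, -⟩ := ne_of_segCross h'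
    have haa' : a ≠ a' := by
      rintro rfl
      simp [orient] at haa
    have hba' : b ≠ a' := by
      rintro rfl
      have := neg_of_mul_neg_right h.2 ha.le
      linarith
    have hab := (ne_of_segCross h).1
    rcases segCross_of_between h ha ha' haa (hP _ _ _ hbd hba' had'.symm)
      (hP _ _ _ hba' hab.symm haa'.symm) (hP _ _ _ had'.symm had.symm haa'.symm) with hx | hx
    · have := hu _ _ hx
      rw [Sym2.eq_iff] at this
      tauto
    · have := hu _ _ hx
      rw [Sym2.eq_iff] at this
      tauto
  by_contra hne
  obtain ⟨-, hcd, hac, had, hbc, hbd⟩ := ne_of_segCross h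
  obtain ⟨-, -, hac', had', -, -⟩ := ne_of_segCross h'
  rcases lt_or_gt_of_ne (hP c a' a hac'.symm hac.symm (Ne.symm hne)) with hlt | hgt
  · refine key h' hu' h ha' ha ?_
    rw [orient_swap]; linarith
  · exact key h hu h' ha ha' hgt

/-- An edge is the only crossing partner of at most one edge. -/
lemma GenPos.crosser_injective {V : Type*} {P : V → Plane} (hP : GenPos P) {a b a' b' c d : V}
    (h : SegCross (P a) (P b) (P c) (P d))
    (hu : ∀ x y, SegCross (P a) (P b) (P x) (P y) → s(x, y) = s(c, d))
    (h' : SegCross (P a') (P b') (P c) (P d))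
    (hu' : ∀ x y, SegCross (P a') (P b') (P x) (P y) → s(x, y) = s(c, d)) :
    s(a, b) = s(a', b') := by
  have main : ∀ {a b a' b' : V}, SegCross (P a) (P b) (P c) (P d) →
      (∀ x y, SegCross (P a) (P b) (P x) (P y) → s(x, y) = s(c, d)) →
      SegCross (P a') (P b') (P c) (P d) →
      (∀ x y, SegCross (P a') (P b') (P x) (P y) → s(x, y) = s(c, d)) →
      0 < orient (P c) (P d) (P a) → 0 < orient (P c) (P d) (P a') → s(a, b) = s(a', b') := by
    intro a b a' b' h hu h' hu' ha ha'
    have e1 : a = a' := hP.left_end_unique h hu h' hu' ha ha'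
    have sw : ∀ {a b : V}, SegCross (P a) (P b) (P c) (P d) → 0 < orient (P c) (P d) (P a) →
        0 < orient (P d) (P c) (P b) := by
      intro a b h ha
      have := neg_of_mul_neg_right h.2 ha.le
      rw [orient_swap']; linarith
    -- Exchanging c and d turns the other side of the line into the positive one.
    have e2 : b = b' := by
      refine hP.left_end_unique (c := d) (d := c) (b := a) (b' := a') ?_ ?_ ?_ ?_ (sw h ha)
        (sw h' ha')
      · rwa [segCross_swap_left, segCross_swap_right]
      · intro x y hxy
        rw [hu x y (by rwa [segCross_swap_left]), Sym2.eq_swap]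
      · rwa [segCross_swap_left, segCross_swap_right]
      · intro x y hxy
        rw [hu' x y (by rwa [segCross_swap_left]), Sym2.eq_swap]
    rw [e1, e2]
  have orientPos : ∀ {a b : V}, SegCross (P a) (P b) (P c) (P d) →
      0 < orient (P c) (P d) (P a) ∨ 0 < orient (P c) (P d) (P b) := by
    intro a b h
    rcases mul_neg_iff.1 h.2 with h | h
    · exact Or.inl h.1
    · exact Or.inr h.2
  have swc : ∀ {a b : V}, SegCross (P a) (P b) (P c) (P d) → SegCross (P b) (P a) (P c) (P d) :=
    fun h => segCross_swap_left.1 h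
  have swu : ∀ {a b : V}, (∀ x y, SegCross (P a) (P b) (P x) (P y) → s(x, y) = s(c, d)) →
      (∀ x y, SegCross (P b) (P a) (P x) (P y) → s(x, y) = s(c, d)) :=
    fun hu x y h => hu x y (segCross_swap_left.1 h)
  rcases orientPos h with ha | hb <;> rcases orientPos h' with ha' | hb'
  · exact main h hu h' hu' ha ha'
  · rw [main h hu (swc h') (swu hu') ha hb', Sym2.eq_swap]
  · rw [Sym2.eq_swap, main (swc h) (swu hu) h' hu' hb ha']
  · rw [Sym2.eq_swap, main (swc h) (swu hu) (swc h') (swu hu') hb hb', Sym2.eq_swap]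

/-! ### The combinatorial model: once-crossed spokes and peaks. -/

/-- The arcs `ij` and `kl` cross, where `s` records the orientations of triples. -/
def ArcCross (s : ℕ → ℕ → ℕ → Prop) (i j k l : ℕ) : Prop :=
  (i < k ∧ k < j ∧ j < l ∧ (s i k j ↔ s k j l)) ∨ (k < i ∧ i < l ∧ l < j ∧ (s k i l ↔ s i l j)) ∨
  (i < k ∧ l < j ∧ ¬(s i k j ↔ s i l j)) ∨ (k < i ∧ j < l ∧ ¬(s k i l ↔ s k j l))

/-- The spoke from the hub to `k` crosses the arc `ij`. -/
def SpokeCross (s : ℕ → ℕ → ℕ → Prop) (k i j : ℕ) : Prop := i < k ∧ k < j ∧ s i k j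

/-- `ij` is an arc on the points `1, …, N`. -/
def IsArc (N i j : ℕ) : Prop := 1 ≤ i ∧ i < j ∧ j ≤ N

/-- The arc `ij` is crossed by the spoke `k` only. -/
def ArcOnlySpoke (N : ℕ) (s : ℕ → ℕ → ℕ → Prop) (i j k : ℕ) : Prop :=
  IsArc N i j ∧ SpokeCross s k i j ∧ (∀ m, SpokeCross s m i j → m = k) ∧
    ∀ x y, IsArc N x y → ¬ArcCross s i j x y

/-- The arc `ij` is crossed by the arc `kl` only. -/
def ArcOnlyArc (N : ℕ) (s : ℕ → ℕ → ℕ → Prop) (i j k l : ℕ) : Prop :=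
  IsArc N i j ∧ IsArc N k l ∧ ArcCross s i j k l ∧ (∀ m, ¬SpokeCross s m i j) ∧
    ∀ x y, IsArc N x y → ArcCross s i j x y → x = k ∧ y = l

/-- The spoke `k` is crossed by the arc `dc` only. -/
def SpokeOnlyArc (N : ℕ) (s : ℕ → ℕ → ℕ → Prop) (k d c : ℕ) : Prop :=
  IsArc N d c ∧ SpokeCross s k d c ∧ ∀ x y, IsArc N x y → SpokeCross s k x y → x = d ∧ y = c

/-- Orientations of triples of `1, …, N` for which every quadruple changes sign at most once and
every edge is the only crosser of at most one edge. -/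
structure SpokeSystem (N : ℕ) (s : ℕ → ℕ → ℕ → Prop) : Prop where
  mono : ∀ a b c d, 1 ≤ a → a < b → b < c → c < d → d ≤ N →
    Mono4 (s a b c) (s a b d) (s a c d) (s b c d)
  spoke_spoke : ∀ k k' d c, SpokeOnlyArc N s k d c → SpokeOnlyArc N s k' d c → k = k'
  spoke_arc : ∀ k d c i j, SpokeOnlyArc N s k d c → ¬ArcOnlyArc N s i j d c
  arc_arc : ∀ i j i' j' k l, ArcOnlyArc N s i j k l → ArcOnlyArc N s i' j' k l → i = i' ∧ j = j'

namespace SpokeSystem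

variable {N : ℕ} {s : ℕ → ℕ → ℕ → Prop}

/-- The arc `(k-1, k+1)` is crossed by the spoke `k` only. -/
def Peak (N : ℕ) (s : ℕ → ℕ → ℕ → Prop) (k : ℕ) : Prop := ArcOnlySpoke N s (k - 1) (k + 1) k

/-- The spoke `k` is crossed by exactly one edge. -/
def OneSpoke (N : ℕ) (s : ℕ → ℕ → ℕ → Prop) (k : ℕ) : Prop := ∃ d c, SpokeOnlyArc N s k d c

/-- The arc `ij` is crossed by exactly one edge, and that edge is an arc. -/
def TopArc (N : ℕ) (s : ℕ → ℕ → ℕ → Prop) (i j : ℕ) : Prop := ∃ k l, ArcOnlyArc N s i j k l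

/-- Another point m strictly between i and j would be on the hub side of ij, whereas k is beyond it;
the arc joining m and k would cross ij. -/
lemma Peak.of_arcOnlySpoke {i j k : ℕ} (h : ArcOnlySpoke N s i j k) :
    i + 1 = k ∧ j = k + 1 := by
  obtain ⟨⟨hi, hij, hj⟩, ⟨hk1, hk2, hk⟩, hu, hx⟩ := h
  have main : ∀ m, i < m → m < j → m = k := by
    intro m hm1 hm2
    by_contra hmk
    have hm : ¬ s i m j := fun h => hmk (hu m ⟨hm1, hm2, h⟩)
    rcases lt_or_gt_of_ne hmk with hlt | hgt
    · exact hx m k ⟨by omega, hlt, by omega⟩ (by unfold ArcCross; tauto)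
    · exact hx k m ⟨by omega, hgt, by omega⟩ (by unfold ArcCross; tauto)
  have h1 := main (i + 1) (by omega) (by omega)
  have h2 := main (j - 1) (by omega) (by omega)
  omega

lemma Peak.bounds {k : ℕ} (h : Peak N s k) : 2 ≤ k ∧ k + 1 ≤ N := by
  obtain ⟨⟨hi, hij, hj⟩, ⟨hk1, hk2, hk⟩, -⟩ := h
  omega

lemma Peak.pos {k : ℕ} (h : Peak N s k) : s (k - 1) k (k + 1) := h.2.1.2.2

lemma Peak.not_cross {k x y : ℕ} (h : Peak N s k) (hxy : IsArc N x y) :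
    ¬ArcCross s (k - 1) (k + 1) x y := h.2.2.2 x y hxy

lemma OneSpoke.bounds {k : ℕ} (h : OneSpoke N s k) : 2 ≤ k ∧ k + 1 ≤ N := by
  obtain ⟨d, c, ⟨h1, h2, h3⟩, ⟨h4, h5, -⟩, -⟩ := h
  omega

/-- The two peak arcs would interlace with equal signs, hence cross each other. -/
lemma not_peak_succ {k : ℕ} (h : Peak N s k) : ¬Peak N s (k + 1) := by
  intro h'
  have b := h.bounds
  have b' := h'.bounds
  have p := h.pos
  have p' := h'.pos
  rw [Nat.add_sub_cancel] at p'
  refine h.not_cross (x := k) (y := k + 2) ⟨by omega, by omega, by omega⟩ (Or.inl ?_)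
  exact ⟨by omega, by omega, by omega, by tauto⟩

variable (h : SpokeSystem N s)
include h

/-- The two crossers dc and d'c' differ. If dc reached past k + 1, then k + 1 would be on its hub
side and (d, k + 1) would be a second crosser of the spoke k. So c = k + 1 and, symmetrically, d' =
k; now the single sign change makes (d, c') a second crosser. -/
lemma not_oneSpoke_succ {k : ℕ} (hk : OneSpoke N s k) : ¬OneSpoke N s (k + 1) := by
  rintro ⟨d', c', h'⟩
  obtain ⟨d, c, hk⟩ := hk
  have hinj := h.spoke_spoke k (k + 1)
  obtain ⟨⟨a1, a2, a3⟩, ⟨a4, a5, a6⟩, hu⟩ := id hk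
  obtain ⟨⟨b1, b2, b3⟩, ⟨b4, b5, b6⟩, hu'⟩ := id h'
  have hc : c = k + 1 := by
    by_contra hc
    have n : ¬ s d (k + 1) c := by
      intro hs
      obtain ⟨rfl, rfl⟩ := hu' d c ⟨by omega, by omega, by omega⟩ ⟨by omega, by omega, hs⟩
      exact absurd (hinj _ _ hk h') (by omega)
    have m := h.mono d k (k + 1) c (by omega) (by omega) (by omega) (by omega) (by omega)
    have : s d k (k + 1) := by unfold Mono4 at m; grind
    have := hu d (k + 1) ⟨by omega, by omega, by omega⟩ ⟨by omega, by omega, this⟩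
    omega
  have hd : d' = k := by
    by_contra hd
    have n : ¬ s d' k c' := by
      intro hs
      obtain ⟨rfl, rfl⟩ := hu d' c' ⟨by omega, by omega, by omega⟩ ⟨by omega, by omega, hs⟩
      exact absurd (hinj _ _ hk h') (by omega)
    have m := h.mono d' k (k + 1) c' (by omega) (by omega) (by omega) (by omega) (by omega)
    have : s k (k + 1) c' := by unfold Mono4 at m; grind
    have := hu' k c' ⟨by omega, by omega, by omega⟩ ⟨by omega, by omega, this⟩
    omega
  subst hc hd
  have m := h.mono d d' (d' + 1) c' (by omega) (by omega) (by omega) (by omega) (by omega)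
  have : s d d' c' := by unfold Mono4 at m; grind
  have := hu d c' ⟨by omega, by omega, by omega⟩ ⟨by omega, by omega, this⟩
  omega

/-- The argument for adjacent spokes applies with k + 2 in place of k + 1: the peak arc (k, k + 2)
is crossed by no arc, so no longer arc can separate k from k + 2. -/
lemma not_oneSpoke_peak_oneSpoke {k : ℕ} (hk : OneSpoke N s k) (hp : Peak N s (k + 1)) :
    ¬OneSpoke N s (k + 2) := by
  rintro ⟨d', c', h'⟩
  obtain ⟨d, c, hk⟩ := hk
  have hinj := h.spoke_spoke k (k + 2)
  have p := hp.pos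
  have nc := fun x y => hp.not_cross (x := x) (y := y)
  simp only [Nat.add_sub_cancel] at p nc
  obtain ⟨⟨a1, a2, a3⟩, ⟨a4, a5, a6⟩, hu⟩ := id hk
  obtain ⟨⟨b1, b2, b3⟩, ⟨b4, b5, b6⟩, hu'⟩ := id h'
  have hc : c = k + 2 := by
    by_contra hc
    rcases eq_or_ne c (k + 1) with rfl | hc'
    · have m := h.mono d k (k + 1) (k + 2) (by omega) (by omega) (by omega) (by omega) (by omega)
      have : s d k (k + 2) := by unfold Mono4 at m; grind
      have := hu d (k + 2) ⟨by omega, by omega, by omega⟩ ⟨by omega, by omega, this⟩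
      omega
    have n : ¬ s d (k + 2) c := by
      intro hs
      obtain ⟨rfl, rfl⟩ := hu' d c ⟨by omega, by omega, by omega⟩ ⟨by omega, by omega, hs⟩
      exact absurd (hinj _ _ hk h') (by omega)
    refine nc d c ⟨by omega, by omega, by omega⟩ (Or.inr (Or.inr (Or.inr ⟨by omega, by omega, ?_⟩)))
    tauto
  have hd : d' = k := by
    by_contra hd
    rcases eq_or_ne d' (k + 1) with rfl | hd'
    · have m := h.mono k (k + 1) (k + 2) c' (by omega) (by omega) (by omega) (by omega) (by omega)
      have : s k (k + 2) c' := by unfold Mono4 at m; grind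
      have := hu' k c' ⟨by omega, by omega, by omega⟩ ⟨by omega, by omega, this⟩
      omega
    have n : ¬ s d' k c' := by
      intro hs
      obtain ⟨rfl, rfl⟩ := hu d' c' ⟨by omega, by omega, by omega⟩ ⟨by omega, by omega, hs⟩
      exact absurd (hinj _ _ hk h') (by omega)
    refine nc d' c' ⟨by omega, by omega, by omega⟩
      (Or.inr (Or.inr (Or.inr ⟨by omega, by omega, ?_⟩)))
    tauto
  subst hc hd
  have m := h.mono d d' (d' + 2) c' (by omega) (by omega) (by omega) (by omega) (by omega)
  have : s d d' c' := by unfold Mono4 at m; grind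
  have := hu d c' ⟨by omega, by omega, by omega⟩ ⟨by omega, by omega, this⟩
  omega

omit h in
lemma short_arc_cross {k x y : ℕ} (hx : ArcCross s k (k + 1) x y) (hxy : x < y) :
    x < k ∧ k + 1 < y ∧ ¬(s x k y ↔ s x (k + 1) y) := by
  rcases hx with hx | hx | hx | hx
  · omega
  · omega
  · omega
  · exact hx

/-- The spoke k is crossed by (k − 1, k + 1) alone. An arc xy crossing (k, k + 1) therefore has k on
the hub side and k + 1 beyond it. Then k + 1 is beyond (k, y), and (k, y) crosses the peak arc. -/
lemma not_topArc_of_peak {k : ℕ} (hk : OneSpoke N s k) (hp : Peak N s k) :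
    ¬TopArc N s k (k + 1) := by
  rintro ⟨x, y, ⟨-, ⟨hx1, hxy, hy⟩, hX, -⟩⟩
  obtain ⟨d, c, ⟨-, -, hu⟩⟩ := hk
  have b := hp.bounds
  have p := hp.pos
  obtain ⟨rfl, rfl⟩ := hu (k - 1) (k + 1) hp.1 hp.2.1
  obtain ⟨h1, h2, h3⟩ := short_arc_cross hX hxy
  have n : ¬ s x k y := by
    intro hs
    have := hu x y ⟨by omega, by omega, by omega⟩ ⟨by omega, by omega, hs⟩
    omega
  have m := h.mono x k (k + 1) y (by omega) (by omega) (by omega) (by omega) (by omega)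
  have q : s k (k + 1) y := by unfold Mono4 at m; grind
  exact hp.not_cross (x := k) (y := y) ⟨by omega, by omega, by omega⟩
    (Or.inl ⟨by omega, by omega, by omega, by tauto⟩)

end SpokeSystem

/-! ### Short arcs around a once-crossed spoke beside a peak. -/

namespace SpokeSystem

variable {N : ℕ} {s : ℕ → ℕ → ℕ → Prop} (h : SpokeSystem N s)
include h

omit h in
lemma _root_.ArcOnlyArc.short {k x y : ℕ} (ha : ArcOnlyArc N s k (k + 1) x y) :
    1 ≤ x ∧ x < k ∧ k + 1 < y ∧ y ≤ N ∧ ¬(s x k y ↔ s x (k + 1) y) ∧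
    ∀ x' y', 1 ≤ x' → x' < k → k + 1 < y' → y' ≤ N → ¬(s x' k y' ↔ s x' (k + 1) y') →
      x' = x ∧ y' = y := by
  obtain ⟨-, ⟨h1, h2, h3⟩, hX, -, hu⟩ := ha
  obtain ⟨i1, i2, i3⟩ := short_arc_cross hX h2
  refine ⟨h1, i1, i2, h3, i3, fun x' y' j1 j2 j3 j4 j5 => hu x' y' ⟨j1, by omega, j4⟩ ?_⟩
  exact Or.inr (Or.inr (Or.inr ⟨j2, j3, j5⟩))

/-- Let xy be the crosser of the middle arc. If y > l + 3, then xy cannot separate l + 1 from l + 3,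
so it also separates l + 2 from l + 3 and is the only crosser of two arcs. If x < l, then (l, l + 3)
must be the only crosser of the spoke l + 1, which is incompatible with the crosser uv of (l, l +
1). -/
lemma middle_crosser {l d c : ℕ} (hs : SpokeOnlyArc N s (l + 1) d c) (hp : Peak N s (l + 2))
    (h1 : TopArc N s l (l + 1)) (h2 : TopArc N s (l + 1) (l + 2))
    (h3 : TopArc N s (l + 2) (l + 3)) :
    ArcOnlyArc N s (l + 1) (l + 2) l (l + 3) := by
  obtain ⟨u, v, h1⟩ := h1
  obtain ⟨x, y, h2⟩ := h2
  obtain ⟨x', y', h3⟩ := h3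
  have p : s (l + 1) (l + 2) (l + 3) := hp.pos
  have b := hp.bounds
  have nc := fun x y => hp.not_cross (x := x) (y := y)
  have nc' : ∀ x y, 1 ≤ x → x < l + 1 → l + 3 < y → y ≤ N → (s x (l + 1) y ↔ s x (l + 3) y) := by
    intro x y i1 i2 i3 i4
    by_contra hcon
    exact nc x y ⟨i1, by omega, i4⟩ (Or.inr (Or.inr (Or.inr ⟨i2, i3, hcon⟩)))
  have hi1 : ArcOnlyArc N s l (l + 1) x y → _ := h.arc_arc _ _ _ _ x y h2
  have hi2 := h.arc_arc _ _ (l + 2) (l + 3) x y h2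
  obtain ⟨u1, u2, u3, u4, u5, u6⟩ := h1.short
  obtain ⟨x1, x2, x3, x4, x5, x6⟩ := h2.short
  obtain ⟨z1, z2, z3, z4, z5, z6⟩ := h3.short
  have hy : y = l + 3 := by
    by_contra hy
    have := nc' x y (by omega) (by omega) (by omega) (by omega)
    obtain ⟨rfl, rfl⟩ := z6 x y (by omega) (by omega) (by omega) (by omega) (by grind)
    have := hi2 h3
    omega
  subst hy
  have hxl : x = l := by
    by_contra hxl
    have m1 := h.mono x (l + 1) (l + 2) (l + 3) (by omega) (by omega) (by omega) (by omega)
      (by omega)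
    have m2 := h.mono x l (l + 1) (l + 2) (by omega) (by omega) (by omega) (by omega) (by omega)
    have q1 : ¬ s x (l + 1) (l + 3) := by unfold Mono4 at m1; grind
    have q2 : s x (l + 2) (l + 3) := by grind
    -- Otherwise (x, l + 3) also crosses (l, l + 1) and is the only crosser of two arcs.
    have q3 : ¬ s x l (l + 3) := by
      intro hc
      obtain ⟨rfl, rfl⟩ := u6 x (l + 3) (by omega) (by omega) (by omega) (by omega) (by grind)
      have := hi1 h1
      omega
    have m3 := h.mono x l (l + 2) (l + 3) (by omega) (by omega) (by omega) (by omega) (by omega)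
    have q4 : s l (l + 2) (l + 3) := by unfold Mono4 at m3; grind
    -- Otherwise (l, l + 3) is a second crosser of the middle arc.
    have q5 : s l (l + 1) (l + 3) := by
      by_contra hc
      have := x6 l (l + 3) (by omega) (by omega) (by omega) (by omega) (by grind)
      omega
    obtain ⟨⟨s1, s2, s3⟩, ⟨s4, s5, s6⟩, su⟩ := hs
    obtain ⟨rfl, rfl⟩ := su l (l + 3) ⟨by omega, by omega, by omega⟩ ⟨by omega, by omega, q5⟩
    -- The spoke l + 1 already has its crosser, so l + 1 is on the hub side of uv, and l is beyond
    -- it.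
    have r1 : ¬ s u (l + 1) v := by
      intro hc
      have := su u v ⟨by omega, by omega, by omega⟩ ⟨by omega, by omega, hc⟩
      omega
    have r2 : s u l v := by grind
    have r3 : ∀ v, l + 2 < v → v ≤ N → u ≠ x ∨ v ≠ l + 3 → ¬ s u (l + 1) v → ¬ s u (l + 2) v := by
      intro v i1 i2 hne i3 i4
      have := x6 u v (by omega) (by omega) (by omega) (by omega) (by grind)
      omega
    have r4 : u ≠ x → ¬ s u (l + 2) (l + 3) := by
      intro hux
      refine r3 _ (by omega) (by omega) (Or.inl hux) ?_
      intro hc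
      have := su u (l + 3) ⟨by omega, by omega, by omega⟩ ⟨by omega, by omega, hc⟩
      omega
    have m4 := h.mono u l (l + 2) (l + 3) (by omega) (by omega) (by omega) (by omega) (by omega)
    have key : s u l (l + 2) → False := by
      intro hc
      rcases eq_or_ne u x with rfl | hux
      · unfold Mono4 at m4; grind
      · have := r4 hux
        unfold Mono4 at m4; grind
    rcases Nat.lt_trichotomy v (l + 3) with hv | hv | hv
    · obtain rfl : v = l + 2 := by omega
      exact key r2
    · subst hv
      rcases eq_or_ne u x with rfl | hux
      · exact q3 r2
      · have := r4 hux
        unfold Mono4 at m4; grind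
    · have m5 := h.mono u l (l + 2) v (by omega) (by omega) (by omega) (by omega) (by omega)
      have := r3 v (by omega) (by omega) (by omega) r1
      exact key (by unfold Mono4 at m5; grind)
  subst hxl
  exact h2

/-- For j = l + 3 the spoke l + 2 crosses the arc. For larger j the arc is also crossed by (l, l +
3), which would be the only crosser of two arcs. The latter argument alone works on the left. -/
lemma not_topArc_right_of_middle {l j : ℕ} (ha : ArcOnlyArc N s (l + 1) (l + 2) l (l + 3))
    (hp : Peak N s (l + 2)) (hj : l + 2 < j) : ¬TopArc N s (l + 1) j := by
  rintro ⟨x, y, hb⟩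
  have p : s (l + 1) (l + 2) (l + 3) := hp.pos
  have hinj := h.arc_arc _ _ (l + 1) j l (l + 3) ha
  obtain ⟨a1, a2, a3, a4, a5, a6⟩ := ha.short
  obtain ⟨⟨b1, b2, b3⟩, ⟨b4, b5, b6⟩, -, hs, hu⟩ := id hb
  have hs2 : ¬ s (l + 1) (l + 2) j := fun hc => hs (l + 2) ⟨by omega, by omega, hc⟩
  have hs3 : l + 3 < j → ¬ s (l + 1) (l + 3) j := fun hc hc' => hs (l + 3) ⟨by omega, by omega, hc'⟩
  have hj3 : l + 3 ≠ j := by rintro rfl; exact hs2 p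
  have m := h.mono l (l + 1) (l + 2) (l + 3) (by omega) (by omega) (by omega) (by omega) (by omega)
  have q : ¬ s l (l + 1) (l + 3) := by unfold Mono4 at m; grind
  obtain ⟨rfl, rfl⟩ := hu l (l + 3) ⟨by omega, by omega, by omega⟩
    (Or.inr (Or.inl ⟨by omega, by omega, by omega, by grind⟩))
  have := hinj hb
  omega

lemma not_topArc_left_of_middle {l j : ℕ} (ha : ArcOnlyArc N s (l + 1) (l + 2) l (l + 3))
    (hp : Peak N s (l + 2)) (hj : j < l) : ¬TopArc N s j (l + 1) := by
  rintro ⟨x, y, hb⟩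
  have p : s (l + 1) (l + 2) (l + 3) := hp.pos
  have hinj := h.arc_arc _ _ j (l + 1) l (l + 3) ha
  obtain ⟨a1, a2, a3, a4, a5, a6⟩ := ha.short
  obtain ⟨⟨b1, b2, b3⟩, ⟨b4, b5, b6⟩, -, hs, hu⟩ := id hb
  have hs2 : ¬ s j l (l + 1) := fun hc => hs l ⟨by omega, by omega, hc⟩
  have m := h.mono l (l + 1) (l + 2) (l + 3) (by omega) (by omega) (by omega) (by omega) (by omega)
  have q : ¬ s l (l + 1) (l + 3) := by unfold Mono4 at m; grind
  obtain ⟨rfl, rfl⟩ := hu l (l + 3) ⟨by omega, by omega, by omega⟩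
    (Or.inl ⟨by omega, by omega, by omega, by grind⟩)
  have := hinj hb
  omega

/-- If (l, l + 2) were a top arc, the crosser uv of (l, l + 1) would have v = l + 2, and (u, l + 3)
would be the crosser of the spoke l + 1. Then every arc (l + 1, z) with z > l + 3 is the only
crosser of (l, l + 2) or of (l + 2, l + 3). This allows two values of z, but l + 6 ≤ N provides
three. -/
lemma not_topArc_two_of_middle {l d c : ℕ} (ha : ArcOnlyArc N s (l + 1) (l + 2) l (l + 3))
    (hp : Peak N s (l + 2)) (hs : SpokeOnlyArc N s (l + 1) d c) (h1 : TopArc N s l (l + 1))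
    (h3 : TopArc N s (l + 2) (l + 3)) (hN : l + 6 ≤ N) : ¬TopArc N s l (l + 2) := by
  rintro ⟨g, g', hb⟩
  obtain ⟨u, v, h1⟩ := h1
  obtain ⟨x', y', h3⟩ := h3
  have p : s (l + 1) (l + 2) (l + 3) := hp.pos
  have hinj := h.arc_arc _ _ l (l + 2) u v h1
  obtain ⟨a1, a2, a3, a4, a5, a6⟩ := ha.short
  obtain ⟨u1, u2, u3, u4, u5, u6⟩ := h1.short
  obtain ⟨z1, z2, z3, z4, z5, z6⟩ := h3.short
  obtain ⟨⟨b1, b2, b3⟩, ⟨b4, b5, b6⟩, -, hb1, hu⟩ := id hb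
  have hs2 : ¬ s l (l + 1) (l + 2) := fun hc => hb1 (l + 1) ⟨by omega, by omega, hc⟩
  have m := h.mono l (l + 1) (l + 2) (l + 3) (by omega) (by omega) (by omega) (by omega) (by omega)
  have q : ¬ s l (l + 1) (l + 3) := by unfold Mono4 at m; grind
  have q' : s l (l + 2) (l + 3) := by grind
  have ha6 : ∀ v, l + 2 < v → v ≤ N → (s u (l + 1) v ↔ s u (l + 2) v) := by
    intro v i1 i2
    by_contra hc
    have := a6 u v (by omega) (by omega) (by omega) (by omega) hc
    omega
  have hv : v = l + 2 := by
    by_contra hv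
    have := ha6 v (by omega) (by omega)
    obtain ⟨rfl, rfl⟩ := hu u v ⟨by omega, by omega, by omega⟩
      (Or.inr (Or.inr (Or.inr ⟨by omega, by omega, by grind⟩)))
    have := hinj hb
    omega
  subst hv
  have m1 := h.mono u l (l + 1) (l + 2) (by omega) (by omega) (by omega) (by omega) (by omega)
  have q1 : s u l (l + 2) := by unfold Mono4 at m1; grind
  have m2 := h.mono u l (l + 2) (l + 3) (by omega) (by omega) (by omega) (by omega) (by omega)
  have q2 : s u (l + 2) (l + 3) := by unfold Mono4 at m2; grind
  have q3 := (ha6 (l + 3) (by omega) (by omega)).2 q2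
  obtain ⟨⟨s1, s2, s3⟩, ⟨s4, s5, s6⟩, su⟩ := hs
  obtain ⟨rfl, rfl⟩ := su u (l + 3) ⟨by omega, by omega, by omega⟩ ⟨by omega, by omega, q3⟩
  have key : ∀ z, l + 3 < z → z ≤ N → (g = l + 1 ∧ g' = z) ∨ (x' = l + 1 ∧ y' = z) := by
    intro z hz1 hz2
    by_cases w1 : s (l + 1) (l + 2) z
    · right
      by_cases w2 : s (l + 1) (l + 3) z
      · have m3 := h.mono u (l + 1) (l + 3) z (by omega) (by omega) (by omega) (by omega) (by omega)
        have := su u z ⟨by omega, by omega, by omega⟩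
          ⟨by omega, by omega, by unfold Mono4 at m3; grind⟩
        omega
      · have := z6 (l + 1) z (by omega) (by omega) (by omega) (by omega) (by grind)
        omega
    · left
      have := hu (l + 1) z ⟨by omega, by omega, by omega⟩
        (Or.inl ⟨by omega, by omega, by omega, by grind⟩)
      omega
  have k1 := key (l + 4) (by omega) (by omega)
  have k2 := key (l + 5) (by omega) (by omega)
  have k3 := key (l + 6) (by omega) (by omega)
  omega

end SpokeSystem

/-! ### Mirror symmetry, and missing short arcs on either side of a peak. -/

namespace SpokeSystem

variable {N : ℕ} {s s' : ℕ → ℕ → ℕ → Prop}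

/-- `s'` is obtained from `s` by reversing the order of the points `1, …, N`. -/
def IsReversal (N : ℕ) (s s' : ℕ → ℕ → ℕ → Prop) : Prop :=
  ∀ i j k i' j' k', 1 ≤ i → i < j → j < k → k ≤ N → i + i' = N + 1 → j + j' = N + 1 →
    k + k' = N + 1 → (s i j k ↔ s' k' j' i')

lemma IsReversal.symm (hr : IsReversal N s s') : IsReversal N s' s :=
  fun i j k i' j' k' h1 h2 h3 h4 h5 h6 h7 =>
    (hr k' j' i' k j i (by omega) (by omega) (by omega) (by omega) (by omega) (by omega)
      (by omega)).symm

lemma isReversal_sub (N : ℕ) (s : ℕ → ℕ → ℕ → Prop) :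
    IsReversal N s (fun i j k => s (N + 1 - k) (N + 1 - j) (N + 1 - i)) := by
  intro i j k i' j' k' h1 h2 h3 h4 h5 h6 h7
  change s i j k ↔ s (N + 1 - i') (N + 1 - j') (N + 1 - k')
  rw [show N + 1 - i' = i by omega, show N + 1 - j' = j by omega, show N + 1 - k' = k by omega]

section Reversal

variable (hr : IsReversal N s s')
include hr

lemma IsReversal.arcCross {i j k l i' j' k' l' : ℕ} (h1 : IsArc N i j) (h2 : IsArc N k l)
    (hi : i + i' = N + 1) (hj : j + j' = N + 1) (hk : k + k' = N + 1) (hl : l + l' = N + 1)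
    (hx : ArcCross s i j k l) : ArcCross s' j' i' l' k' := by
  obtain ⟨a1, a2, a3⟩ := h1
  obtain ⟨b1, b2, b3⟩ := h2
  rcases hx with ⟨c1, c2, c3, c4⟩ | ⟨c1, c2, c3, c4⟩ | ⟨c1, c2, c4⟩ | ⟨c1, c2, c4⟩
  · rw [hr i k j i' k' j' a1 c1 c2 a3 hi hk hj,
      hr k j l k' j' l' b1 c2 c3 b3 hk hj hl] at c4
    exact Or.inr (Or.inl ⟨by omega, by omega, by omega, c4.symm⟩)
  · rw [hr k i l k' i' l' b1 c1 c2 b3 hk hi hl,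
      hr i l j i' l' j' a1 c2 c3 a3 hi hl hj] at c4
    exact Or.inl ⟨by omega, by omega, by omega, c4.symm⟩
  · rw [hr i k j i' k' j' a1 c1 (by omega) a3 hi hk hj,
      hr i l j i' l' j' a1 (by omega) c2 a3 hi hl hj] at c4
    exact Or.inr (Or.inr (Or.inl ⟨by omega, by omega, fun h => c4 h.symm⟩))
  · rw [hr k i l k' i' l' b1 c1 (by omega) b3 hk hi hl,
      hr k j l k' j' l' b1 (by omega) c2 b3 hk hj hl] at c4
    exact Or.inr (Or.inr (Or.inr ⟨by omega, by omega, fun h => c4 h.symm⟩))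

lemma IsReversal.spokeCross {k i j k' i' j' : ℕ} (h1 : IsArc N i j) (hi : i + i' = N + 1)
    (hj : j + j' = N + 1) (hk : k + k' = N + 1) (hx : SpokeCross s k i j) :
    SpokeCross s' k' j' i' := by
  obtain ⟨a1, a2, a3⟩ := h1
  obtain ⟨c1, c2, c3⟩ := hx
  exact ⟨by omega, by omega, (hr i k j i' k' j' a1 c1 c2 a3 hi hk hj).1 c3⟩

lemma IsReversal.arcOnlySpoke {k i j k' i' j' : ℕ} (hi : i + i' = N + 1) (hj : j + j' = N + 1)
    (hk : k + k' = N + 1) (hx : ArcOnlySpoke N s i j k) : ArcOnlySpoke N s' j' i' k' := by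
  obtain ⟨ha, hs, hu, hc⟩ := hx
  have ha' := ha
  obtain ⟨a1, a2, a3⟩ := ha'
  refine ⟨⟨by omega, by omega, by omega⟩, hr.spokeCross ha hi hj hk hs, fun m hm => ?_,
    fun x y hxy hX => ?_⟩
  · have := hm.1
    have := hm.2.1
    have := hu (N + 1 - m) (hr.symm.spokeCross ⟨by omega, by omega, by omega⟩ (by omega)
      (by omega) (by omega) hm)
    omega
  · obtain ⟨b1, b2, b3⟩ := id hxy
    exact hc (N + 1 - y) (N + 1 - x) ⟨by omega, by omega, by omega⟩
      (hr.symm.arcCross ⟨by omega, by omega, by omega⟩ hxy (by omega) (by omega) (by omega)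
        (by omega) hX)

lemma IsReversal.arcOnlyArc {i j k l i' j' k' l' : ℕ} (hi : i + i' = N + 1) (hj : j + j' = N + 1)
    (hk : k + k' = N + 1) (hl : l + l' = N + 1) (hx : ArcOnlyArc N s i j k l) :
    ArcOnlyArc N s' j' i' l' k' := by
  obtain ⟨ha, hb, hX, hs, hc⟩ := hx
  have ha' := ha
  obtain ⟨a1, a2, a3⟩ := ha'
  have hb' := hb
  obtain ⟨b1, b2, b3⟩ := hb'
  refine ⟨⟨by omega, by omega, by omega⟩, ⟨by omega, by omega, by omega⟩,
    hr.arcCross ha hb hi hj hk hl hX, fun m hm => ?_, fun x y hxy hX => ?_⟩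
  · have := hm.1
    have := hm.2.1
    exact hs (N + 1 - m) (hr.symm.spokeCross ⟨by omega, by omega, by omega⟩ (by omega)
      (by omega) (by omega) hm)
  · obtain ⟨b1, b2, b3⟩ := id hxy
    have := hc (N + 1 - y) (N + 1 - x) ⟨by omega, by omega, by omega⟩
      (hr.symm.arcCross ⟨by omega, by omega, by omega⟩ hxy (by omega) (by omega) (by omega)
        (by omega) hX)
    omega

lemma IsReversal.spokeOnlyArc {k i j k' i' j' : ℕ} (hi : i + i' = N + 1) (hj : j + j' = N + 1)
    (hk : k + k' = N + 1) (hx : SpokeOnlyArc N s k i j) : SpokeOnlyArc N s' k' j' i' := by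
  obtain ⟨ha, hs, hu⟩ := hx
  have ha' := ha
  obtain ⟨a1, a2, a3⟩ := ha'
  refine ⟨⟨by omega, by omega, by omega⟩, hr.spokeCross ha hi hj hk hs, fun x y hxy hX => ?_⟩
  obtain ⟨b1, b2, b3⟩ := id hxy
  have := hX.1
  have := hX.2.1
  have := hu (N + 1 - y) (N + 1 - x) ⟨by omega, by omega, by omega⟩
    (hr.symm.spokeCross hxy (by omega) (by omega) (by omega) hX)
  omega

lemma IsReversal.peak {k k' : ℕ} (hk : k + k' = N + 1) (hp : Peak N s k) : Peak N s' k' := by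
  have := hp.bounds
  exact hr.arcOnlySpoke (by omega) (by omega) hk hp

lemma IsReversal.oneSpoke {k k' : ℕ} (hk : k + k' = N + 1) (hp : OneSpoke N s k) :
    OneSpoke N s' k' := by
  obtain ⟨d, c, hp⟩ := hp
  obtain ⟨⟨b1, b2, b3⟩, -⟩ := id hp
  exact ⟨N + 1 - c, N + 1 - d, hr.spokeOnlyArc (by omega) (by omega) hk hp⟩

lemma IsReversal.topArc {i j i' j' : ℕ} (hi : i + i' = N + 1) (hj : j + j' = N + 1)
    (hp : TopArc N s i j) : TopArc N s' j' i' := by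
  obtain ⟨d, c, hp⟩ := hp
  obtain ⟨-, ⟨b1, b2, b3⟩, -⟩ := id hp
  exact ⟨N + 1 - c, N + 1 - d, hr.arcOnlyArc hi hj (by omega) (by omega) hp⟩

lemma IsReversal.spokeSystem (h : SpokeSystem N s) : SpokeSystem N s' where
  mono a b c d h1 h2 h3 h4 h5 := by
    have m := h.mono (N + 1 - d) (N + 1 - c) (N + 1 - b) (N + 1 - a) (by omega) (by omega)
      (by omega) (by omega) (by omega)
    rw [← hr.symm b c d _ _ _ (by omega) (by omega) (by omega) (by omega) (Nat.add_sub_of_le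
      (by omega)) (Nat.add_sub_of_le (by omega)) (Nat.add_sub_of_le (by omega)),
      ← hr.symm a c d _ _ _ (by omega) (by omega) (by omega) (by omega) (Nat.add_sub_of_le
      (by omega)) (Nat.add_sub_of_le (by omega)) (Nat.add_sub_of_le (by omega)),
      ← hr.symm a b d _ _ _ (by omega) (by omega) (by omega) (by omega) (Nat.add_sub_of_le
      (by omega)) (Nat.add_sub_of_le (by omega)) (Nat.add_sub_of_le (by omega)),
      ← hr.symm a b c _ _ _ (by omega) (by omega) (by omega) (by omega) (Nat.add_sub_of_le
      (by omega)) (Nat.add_sub_of_le (by omega)) (Nat.add_sub_of_le (by omega))] at m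
    unfold Mono4 at m ⊢
    grind
  spoke_spoke k k' d c h1 h2 := by
    obtain ⟨⟨a1, a2, a3⟩, ⟨a4, a5, -⟩, -⟩ := id h1
    obtain ⟨-, ⟨b4, b5, -⟩, -⟩ := id h2
    have := h.spoke_spoke (N + 1 - k) (N + 1 - k') (N + 1 - c) (N + 1 - d)
      (hr.symm.spokeOnlyArc (by omega) (by omega) (by omega) h1)
      (hr.symm.spokeOnlyArc (by omega) (by omega) (by omega) h2)
    omega
  spoke_arc k d c i j h1 h2 := by
    obtain ⟨⟨a1, a2, a3⟩, ⟨a4, a5, -⟩, -⟩ := id h1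
    obtain ⟨⟨b1, b2, b3⟩, -⟩ := id h2
    exact h.spoke_arc (N + 1 - k) (N + 1 - c) (N + 1 - d) (N + 1 - j) (N + 1 - i)
      (hr.symm.spokeOnlyArc (by omega) (by omega) (by omega) h1)
      (hr.symm.arcOnlyArc (by omega) (by omega) (by omega) (by omega) h2)
  arc_arc i j i' j' k l h1 h2 := by
    obtain ⟨⟨a1, a2, a3⟩, ⟨a4, a5, a6⟩, -⟩ := id h1
    obtain ⟨⟨b1, b2, b3⟩, -⟩ := id h2
    have := h.arc_arc (N + 1 - j) (N + 1 - i) (N + 1 - j') (N + 1 - i') (N + 1 - l) (N + 1 - k)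
      (hr.symm.arcOnlyArc (by omega) (by omega) (by omega) (by omega) h1)
      (hr.symm.arcOnlyArc (by omega) (by omega) (by omega) (by omega) h2)
    omega

end Reversal

/-- `xy` is an arc between neighbours, or one spanning `k` alone with no longer top arc at `k`. -/
def ShortAt (N : ℕ) (s : ℕ → ℕ → ℕ → Prop) (k x y : ℕ) : Prop :=
  y = x + 1 ∨ (x + 1 = k ∧ y = k + 1 ∧ (∀ j, k + 1 < j → ¬TopArc N s k j) ∧
    ∀ j, j + 1 < k → ¬TopArc N s j k)

variable (h : SpokeSystem N s)
include h

/-- If the three arcs between neighbours are all top arcs, `middle_crosser` applies, and (k − 1, k +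
1) is missing together with all longer top arcs at k. The latter keeps the missing arc from
interlacing the family counted later. -/
lemma exists_missing_right {k : ℕ} (hk : OneSpoke N s k) (hp : Peak N s (k + 1))
    (hN : k + 5 ≤ N) : ∃ x y, IsArc N x y ∧ ¬TopArc N s x y ∧ ShortAt N s k x y ∧
      k ≤ x + 1 ∧ x ≤ k + 1 := by
  have b := hk.bounds
  obtain ⟨l, rfl⟩ : ∃ l, k = l + 1 := ⟨k - 1, by omega⟩
  obtain ⟨d, c, hk⟩ := hk
  by_cases h1 : TopArc N s l (l + 1)
  swap
  · exact ⟨l, l + 1, ⟨by omega, by omega, by omega⟩, h1, Or.inl rfl, by omega, by omega⟩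
  by_cases h2 : TopArc N s (l + 1) (l + 2)
  swap
  · exact ⟨l + 1, l + 2, ⟨by omega, by omega, by omega⟩, h2, Or.inl rfl, by omega, by omega⟩
  by_cases h3 : TopArc N s (l + 2) (l + 3)
  swap
  · exact ⟨l + 2, l + 3, ⟨by omega, by omega, by omega⟩, h3, Or.inl rfl, by omega, by omega⟩
  have hm := h.middle_crosser hk hp h1 h2 h3
  refine ⟨l, l + 2, ⟨by omega, by omega, by omega⟩,
    h.not_topArc_two_of_middle hm hp hk h1 h3 (by omega), Or.inr ⟨rfl, rfl, ?_, ?_⟩,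
    by omega, by omega⟩
  · exact fun j hj => h.not_topArc_right_of_middle hm hp hj
  · exact fun j hj => h.not_topArc_left_of_middle hm hp (by omega)

lemma exists_missing_left {k : ℕ} (hk : OneSpoke N s k) (hp : Peak N s (k - 1))
    (hN : 6 ≤ k) : ∃ x y, IsArc N x y ∧ ¬TopArc N s x y ∧ ShortAt N s k x y ∧
      k ≤ x + 2 ∧ x ≤ k := by
  have b := hk.bounds
  have hr := isReversal_sub N s
  obtain ⟨x, y, ⟨a1, a2, a3⟩, h2, h3, h4, h5⟩ := (hr.spokeSystem h).exists_missing_right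
    (hr.oneSpoke (k' := N + 1 - k) (by omega) hk) (hr.peak (by omega) hp) (by omega)
  refine ⟨N + 1 - y, N + 1 - x, ⟨by omega, by omega, by omega⟩,
    fun ht => h2 (hr.topArc (by omega) (by omega) ht), ?_, ?_, ?_⟩
  · rcases h3 with h3 | ⟨c1, c2, c3, c4⟩
    · exact Or.inl (by omega)
    · refine Or.inr ⟨by omega, by omega, fun j hj ht => ?_, fun j hj ht => ?_⟩
      · obtain ⟨_, _, ⟨d1, d2, d3⟩, -⟩ := id ht
        exact c4 (N + 1 - j) (by omega) (hr.topArc (by omega) (by omega) ht)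
      · obtain ⟨_, _, ⟨d1, d2, d3⟩, -⟩ := id ht
        exact c3 (N + 1 - j) (by omega) (hr.topArc (by omega) (by omega) ht)
  · rcases h3 with h3 | ⟨c1, c2, c3, c4⟩ <;> omega
  · rcases h3 with h3 | ⟨c1, c2, c3, c4⟩ <;> omega

end SpokeSystem

/-! ### Two counting bounds. -/

/-- A family of arcs on `1, …, N`, no two of which interlace, has at most `2(N-1)` members. -/
lemma card_le_of_not_interlace {N : ℕ} {M : Finset (ℕ × ℕ)} (ha : ∀ p ∈ M, IsArc N p.1 p.2)
    (hM : ∀ p ∈ M, ∀ q ∈ M, ¬(p.1 < q.1 ∧ q.1 < p.2 ∧ p.2 < q.2)) : M.card ≤ 2 * (N - 1) := by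
  classical
  -- The longest arcs at their left ends, then at their right ends. An arc in neither set could be
  -- lengthened at each end within the family, and the two longer arcs would interlace.
  set A := M.filter (fun p => ∀ q ∈ M, q.1 = p.1 → q.2 ≤ p.2) with hA
  set B := M.filter (fun p => ∀ q ∈ M, q.2 = p.2 → p.1 ≤ q.1) with hB
  have hAB : M ⊆ A ∪ B := by
    intro p hp
    by_contra hcon
    simp only [hA, hB, Finset.mem_union, Finset.mem_filter, hp, true_and, not_or] at hcon
    push Not at hcon
    obtain ⟨⟨q, hq, q1, q2⟩, ⟨r, hr, r1, r2⟩⟩ := hcon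
    have := (ha p hp).2.1
    exact hM r hr q hq ⟨by omega, by omega, by omega⟩
  have h1 : A.card ≤ (Finset.Ico 1 N).card := by
    refine Finset.card_le_card_of_injOn Prod.fst (fun p hp => ?_) (fun p hp q hq hpq => ?_)
    · simp only [hA, Finset.coe_filter, Set.mem_ofPred_eq] at hp
      obtain ⟨a1, a2, a3⟩ := ha p hp.1
      simp only [Finset.coe_Ico, Set.mem_Ico]
      omega
    · simp only [hA, Finset.coe_filter, Set.mem_ofPred_eq] at hp hq
      exact Prod.ext hpq (le_antisymm (hq.2 p hp.1 hpq) (hp.2 q hq.1 hpq.symm))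
  have h2 : B.card ≤ (Finset.Ioc 1 N).card := by
    refine Finset.card_le_card_of_injOn Prod.snd (fun p hp => ?_) (fun p hp q hq hpq => ?_)
    · simp only [hB, Finset.coe_filter, Set.mem_ofPred_eq] at hp
      obtain ⟨a1, a2, a3⟩ := ha p hp.1
      simp only [Finset.coe_Ioc, Set.mem_Ioc]
      omega
    · simp only [hB, Finset.coe_filter, Set.mem_ofPred_eq] at hp hq
      exact Prod.ext (le_antisymm (hp.2 q hq.1 hpq.symm) (hq.2 p hp.1 hpq)) hpq
  have h3 := (Finset.card_le_card hAB).trans (Finset.card_union_le A B)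
  simp only [Nat.card_Ico, Nat.card_Ioc] at h1 h2
  omega

/-- A subset of `1, …, N` without two consecutive elements has at most `(N+1)/2` elements. -/
lemma card_le_of_not_consecutive {N : ℕ} {A : Finset ℕ} (hA : ∀ k ∈ A, 1 ≤ k ∧ k ≤ N)
    (hc : ∀ k ∈ A, k + 1 ∉ A) : A.card ≤ (N + 1) / 2 := by
  have : A.card ≤ (Finset.Icc 1 ((N + 1) / 2)).card := by
    -- The fibres of the map are the pairs {1, 2}, {3, 4}, ….
    refine Finset.card_le_card_of_injOn (fun k => (k + 1) / 2) (fun k hk => ?_)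
      (fun k hk l hl hkl => ?_)
    · have := hA k hk
      simp only [Finset.coe_Icc, Set.mem_Icc]
      omega
    · have h1 := hc k hk
      have h2 := hc l hl
      simp only at hkl
      by_contra hne
      rcases (by omega : k + 1 = l ∨ l + 1 = k) with rfl | rfl
      · exact h1 hl
      · exact h2 hk
  simpa using this

/-! ### Interlacing top arcs and the arcs spanning them. -/

namespace SpokeSystem

variable {N : ℕ} {s : ℕ → ℕ → ℕ → Prop}

lemma TopArc.isArc {i j : ℕ} (ht : TopArc N s i j) : IsArc N i j := by
  obtain ⟨_, _, ht⟩ := ht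
  exact ht.1

lemma TopArc.below {i j m : ℕ} (ht : TopArc N s i j) (h1 : i < m) (h2 : m < j) : ¬s i m j := by
  obtain ⟨_, _, ht⟩ := ht
  exact fun h => ht.2.2.2.1 m ⟨h1, h2, h⟩

/-- No intermediate point is beyond a top arc, so interlacing top arcs have equal signs and cross.
-/
lemma TopArc.arcOnlyArc {i j k l : ℕ} (h1 : TopArc N s i k) (h2 : TopArc N s j l) (hij : i < j)
    (hjk : j < k) (hkl : k < l) : ArcOnlyArc N s i k j l ∧ ArcOnlyArc N s j l i k := by
  have hs : s i j k ↔ s j k l := by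
    have := h1.below hij hjk
    have := h2.below hjk hkl
    tauto
  have a1 := h1.isArc
  have a2 := h2.isArc
  obtain ⟨x, y, h1⟩ := h1
  obtain ⟨z, w, h2⟩ := h2
  obtain ⟨rfl, rfl⟩ := h1.2.2.2.2 j l a2 (Or.inl ⟨hij, hjk, hkl, hs⟩)
  obtain ⟨rfl, rfl⟩ := h2.2.2.2.2 i k a1 (Or.inr (Or.inl ⟨hij, hjk, hkl, hs⟩))
  exact ⟨h1, h2⟩

variable (h : SpokeSystem N s)
include h

/-- The single sign change on i, j, k, l puts j and k on the hub side of il. Any other m is then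
compared with k if m < k, and with j if m > k. -/
lemma union_below {i j k l m : ℕ} (h1 : ArcOnlyArc N s i k j l) (h2 : ArcOnlyArc N s j l i k)
    (hij : i < j) (hjk : j < k) (hkl : k < l) (him : i < m) (hml : m < l) : ¬s i m l := by
  have b1 : ∀ m, i < m → m < k → ¬s i m k := fun m a b c => h1.2.2.2.1 m ⟨a, b, c⟩
  have b2 : ∀ m, j < m → m < l → ¬s j m l := fun m a b c => h2.2.2.2.1 m ⟨a, b, c⟩
  obtain ⟨⟨a1, a2, a3⟩, ⟨a4, a5, a6⟩, -⟩ := h1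
  have m1 := h.mono i j k l (by omega) hij hjk hkl a6
  have c1 := b1 j hij hjk
  have c2 := b2 k hjk hkl
  rcases Nat.lt_trichotomy m k with hm | hm | hm
  · have m2 := h.mono i m k l (by omega) him hm hkl a6
    have := b1 m him hm
    unfold Mono4 at m1 m2
    grind
  · subst hm
    unfold Mono4 at m1
    grind
  · have m2 := h.mono i j m l (by omega) hij (by omega) hml a6
    have := b2 m (by omega) hml
    unfold Mono4 at m1 m2
    grind

/-- If `j` is above and `i, k` are below the line through `x, y`, then `j` is above `ik`. -/
lemma above_of_between {x i j k y : ℕ} (hx : 1 ≤ x) (hxi : x < i) (hij : i < j) (hjk : j < k)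
    (hky : k < y) (hy : y ≤ N) (h1 : ¬s x i y) (h2 : s x j y) (h3 : ¬s x k y) : s i j k := by
  have m1 := h.mono x i j y (by omega) hxi hij (by omega) hy
  have m2 := h.mono x j k y (by omega) (by omega) hjk (by omega) hy
  have m3 := h.mono x i j k (by omega) hxi hij hjk (by omega)
  unfold Mono4 at m1 m2 m3
  grind

/-- If i were on the hub side of xy, then ik or jl would acquire a second crosser, or j would lie
beyond the top arc ik. -/
lemma union_not_alternate {i j k l x y : ℕ} (h1 : ArcOnlyArc N s i k j l)
    (h2 : ArcOnlyArc N s j l i k) (hij : i < j) (hjk : j < k) (hkl : k < l) (hx : 1 ≤ x)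
    (hxi : x < i) (hiy : i < y) (hyl : y < l) : s x i y := by
  have b1 : ∀ m, i < m → m < k → ¬s i m k := fun m a b c => h1.2.2.2.1 m ⟨a, b, c⟩
  have b2 : ∀ m, j < m → m < l → ¬s j m l := fun m a b c => h2.2.2.2.1 m ⟨a, b, c⟩
  obtain ⟨⟨a1, a2, a3⟩, ⟨a4, a5, a6⟩, -, -, u1⟩ := h1
  obtain ⟨-, -, -, -, u2⟩ := h2
  by_contra hn
  rcases Nat.lt_trichotomy y k with hy | hy | hy
  · have := u1 x y ⟨by omega, by omega, by omega⟩
      (Or.inr (Or.inl ⟨hxi, hiy, hy, by have := b1 y hiy hy; tauto⟩))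
    omega
  · subst hy
    have q : s x j y := by
      by_contra hc
      have := u2 x y ⟨by omega, by omega, by omega⟩
        (Or.inr (Or.inl ⟨by omega, hjk, hyl, by have := b2 y hjk hyl; tauto⟩))
      omega
    have m := h.mono x i j y (by omega) hxi hij hjk (by omega)
    have := b1 j hij hjk
    unfold Mono4 at m
    grind
  · have q1 : ¬s x k y := by
      intro hc
      have := u1 x y ⟨by omega, by omega, by omega⟩
        (Or.inr (Or.inr (Or.inr ⟨hxi, hy, by tauto⟩)))
      omega
    have q2 : s x j y := by
      by_contra hc
      have := u2 x y ⟨by omega, by omega, by omega⟩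
        (Or.inr (Or.inl ⟨by omega, by omega, hyl, by have := b2 y (by omega) hyl; tauto⟩))
      omega
    exact b1 j hij hjk (h.above_of_between hx hxi hij hjk hy (by omega) hn q2 q1)

/-- The arc joining the far ends of two top arcs that cross is uncrossed. -/
lemma union_uncrossed {i j k l x y : ℕ} (h1 : ArcOnlyArc N s i k j l)
    (h2 : ArcOnlyArc N s j l i k) (hij : i < j) (hjk : j < k) (hkl : k < l) (hxy : IsArc N x y) :
    ¬ArcCross s i l x y := by
  have ub := fun m => h.union_below h1 h2 hij hjk hkl (m := m)
  obtain ⟨c1, c2, c3⟩ := hxy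
  rintro (⟨d1, d2, d3, d4⟩ | ⟨d1, d2, d3, d4⟩ | ⟨d1, d2, d3⟩ | ⟨d1, d2, d3⟩)
  · have hr := isReversal_sub N s
    obtain ⟨⟨a1, a2, a3⟩, ⟨a4, a5, a6⟩, -⟩ := id h1
    have e := (hr.spokeSystem h).union_not_alternate
      (hr.arcOnlyArc (i' := N + 1 - j) (j' := N + 1 - l) (k' := N + 1 - i) (l' := N + 1 - k)
        (by omega) (by omega) (by omega) (by omega) h2)
      (hr.arcOnlyArc (by omega) (by omega) (by omega) (by omega) h1)
      (by omega) (by omega) (by omega) (x := N + 1 - y) (y := N + 1 - x) (by omega) (by omega)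
      (by omega) (by omega)
    have e' := (hr x l y (N + 1 - x) (N + 1 - l) (N + 1 - y) c1 d2 d3 c3 (by omega) (by omega)
      (by omega)).2 e
    exact ub x d1 d2 (d4.2 e')
  · have := h.union_not_alternate h1 h2 hij hjk hkl c1 d1 d2 d3
    exact ub y d2 d3 (d4.1 this)
  · have := ub x d1 (by omega)
    have := ub y (by omega) d2
    tauto
  · have b1 : ∀ m, i < m → m < k → ¬s i m k := fun m a b c => h1.2.2.2.1 m ⟨a, b, c⟩
    have b2 : ∀ m, j < m → m < l → ¬s j m l := fun m a b c => h2.2.2.2.1 m ⟨a, b, c⟩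
    obtain ⟨-, -, -, -, u1⟩ := h1
    obtain ⟨-, -, -, -, u2⟩ := h2
    -- Since xy crosses neither ik nor jl, i and k are on one side of it, as are j and l. If xy
    -- separated i from l, the sides would alternate along i, j, k, l, putting k beyond jl or j
    -- beyond ik.
    have q1 : s x i y ↔ s x k y := by
      by_contra hc
      have := u1 x y ⟨by omega, by omega, by omega⟩
        (Or.inr (Or.inr (Or.inr ⟨by omega, by omega, hc⟩)))
      omega
    have q2 : s x j y ↔ s x l y := by
      by_contra hc
      have := u2 x y ⟨by omega, by omega, by omega⟩
        (Or.inr (Or.inr (Or.inr ⟨by omega, by omega, hc⟩)))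
      omega
    by_cases hi : s x i y
    · have := b2 k hjk hkl
      exact this (h.above_of_between c1 (by omega) hjk hkl d2 c3 (by grind) (by grind) (by grind))
    · have := b1 j hij hjk
      exact this (h.above_of_between c1 d1 hij hjk (by omega) c3 (by grind) (by grind) (by grind))

end SpokeSystem

/-! ### Counting once-crossed spokes, peaks and top arcs. -/

namespace SpokeSystem

open Classical in
/-- The arcs crossed by exactly one edge, that edge being an arc. -/
noncomputable def topArcs (N : ℕ) (s : ℕ → ℕ → ℕ → Prop) : Finset (ℕ × ℕ) :=
  (Finset.Icc 1 N ×ˢ Finset.Icc 1 N).filter (fun p => TopArc N s p.1 p.2)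

open Classical in
/-- The spokes crossed by exactly one edge. -/
noncomputable def oneSpokes (N : ℕ) (s : ℕ → ℕ → ℕ → Prop) : Finset ℕ :=
  (Finset.Icc 1 N).filter (OneSpoke N s)

open Classical in
/-- The spokes that are the only crosser of an arc. -/
noncomputable def peaks (N : ℕ) (s : ℕ → ℕ → ℕ → Prop) : Finset ℕ :=
  (Finset.Icc 1 N).filter (Peak N s)

open Classical in
/-- The arcs joining the far ends of two crossing top arcs. -/
noncomputable def unionArcs (N : ℕ) (s : ℕ → ℕ → ℕ → Prop) : Finset (ℕ × ℕ) :=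
  (Finset.Icc 1 N ×ˢ Finset.Icc 1 N).filter (fun p => ∃ j k, TopArc N s p.1 k ∧ TopArc N s j p.2 ∧
    p.1 < j ∧ j < k ∧ k < p.2)

open Classical in
/-- The top arcs that cross another top arc to their left. -/
noncomputable def rightArcs (N : ℕ) (s : ℕ → ℕ → ℕ → Prop) : Finset (ℕ × ℕ) :=
  (topArcs N s).filter (fun p => ∃ i k, TopArc N s i k ∧ i < p.1 ∧ p.1 < k ∧ k < p.2)

variable {N : ℕ} {s : ℕ → ℕ → ℕ → Prop}

lemma mem_topArcs {p : ℕ × ℕ} : p ∈ topArcs N s ↔ TopArc N s p.1 p.2 := by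
  simp only [topArcs, Finset.mem_filter, Finset.mem_product, Finset.mem_Icc, and_iff_right_iff_imp]
  intro h
  obtain ⟨h1, h2, h3⟩ := h.isArc
  omega

lemma mem_oneSpokes {k : ℕ} : k ∈ oneSpokes N s ↔ OneSpoke N s k := by
  simp only [oneSpokes, Finset.mem_filter, Finset.mem_Icc, and_iff_right_iff_imp]
  intro h
  have := h.bounds
  omega

lemma mem_peaks {k : ℕ} : k ∈ peaks N s ↔ Peak N s k := by
  simp only [peaks, Finset.mem_filter, Finset.mem_Icc, and_iff_right_iff_imp]
  intro h
  have := h.bounds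
  omega

lemma mem_unionArcs {p : ℕ × ℕ} : p ∈ unionArcs N s ↔ ∃ j k, TopArc N s p.1 k ∧
    TopArc N s j p.2 ∧ p.1 < j ∧ j < k ∧ k < p.2 := by
  simp only [unionArcs, Finset.mem_filter, Finset.mem_product, Finset.mem_Icc,
    and_iff_right_iff_imp]
  rintro ⟨j, k, h, h', h''⟩
  obtain ⟨h1, h2, h3⟩ := h.isArc
  obtain ⟨h4, h5, h6⟩ := h'.isArc
  omega

lemma mem_rightArcs {p : ℕ × ℕ} : p ∈ rightArcs N s ↔ TopArc N s p.1 p.2 ∧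
    ∃ i k, TopArc N s i k ∧ i < p.1 ∧ p.1 < k ∧ k < p.2 := by
  simp only [rightArcs, Finset.mem_filter, mem_topArcs]

/-- Send (j, l) to its spanning arc (i, l). If (j, l) and (j', l) with j < j' had the same image,
the left arc crossing (j', l) would also cross (j, l). -/
lemma card_rightArcs_le : (rightArcs N s).card ≤ (unionArcs N s).card := by
  refine Finset.card_le_card_of_forall_subsingleton (fun p q => q.2 = p.2 ∧
    ∃ k, TopArc N s p.1 p.2 ∧ TopArc N s q.1 k ∧ q.1 < p.1 ∧ p.1 < k ∧ k < p.2) ?_ ?_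
  · rintro ⟨j, l⟩ hp
    obtain ⟨h1, i, k, h2, h3, h4, h5⟩ := mem_rightArcs.1 hp
    exact ⟨(i, l), mem_unionArcs.2 ⟨j, k, h2, h1, h3, h4, h5⟩, rfl, k, h1, h2, h3, h4, h5⟩
  · rintro ⟨i, l⟩ - ⟨j, l1⟩ ⟨-, h1, k, h2, h3, h4, h5, h6⟩ ⟨j', l2⟩ ⟨-, h1', k', h2', h3', h4', h5', h6'⟩
    simp only at *
    subst h1 h1'
    obtain ⟨a, a'⟩ := h3.arcOnlyArc h2 h4 h5 h6
    obtain ⟨b, b'⟩ := h3'.arcOnlyArc h2' h4' h5' h6'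
    rcases Nat.lt_trichotomy j j' with hj | hj | hj
    · obtain ⟨c, -⟩ := h3'.arcOnlyArc h2 h4 (by omega) h6'
      obtain ⟨e, -⟩ := c.2.2.2.2 j' l b.2.1 b.2.2.1
      omega
    · rw [hj]
    · obtain ⟨c, -⟩ := h3.arcOnlyArc h2' h4' (by omega) h6
      obtain ⟨e, -⟩ := c.2.2.2.2 j l a.2.1 a.2.2.1
      omega

variable (h : SpokeSystem N s)
include h

lemma unionArcs_uncrossed {p : ℕ × ℕ} (hp : p ∈ unionArcs N s) {x y : ℕ} (hxy : IsArc N x y) :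
    ¬ArcCross s p.1 p.2 x y := by
  obtain ⟨j, k, h1, h2, h3, h4, h5⟩ := mem_unionArcs.1 hp
  obtain ⟨a, b⟩ := h1.arcOnlyArc h2 h3 h4 h5
  exact h.union_uncrossed a b h3 h4 h5 hxy

lemma unionArcs_below {p : ℕ × ℕ} (hp : p ∈ unionArcs N s) {m : ℕ} (h1 : p.1 < m)
    (h2 : m < p.2) : ¬s p.1 m p.2 := by
  obtain ⟨j, k, a1, a2, h3, h4, h5⟩ := mem_unionArcs.1 hp
  obtain ⟨a, b⟩ := a1.arcOnlyArc a2 h3 h4 h5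
  exact h.union_below a b h3 h4 h5 h1 h2

omit h in
lemma unionArcs_isArc {p : ℕ × ℕ} (hp : p ∈ unionArcs N s) :
    IsArc N p.1 p.2 ∧ p.1 + 3 ≤ p.2 := by
  obtain ⟨j, k, a1, a2, h3, h4, h5⟩ := mem_unionArcs.1 hp
  obtain ⟨b1, b2, b3⟩ := a1.isArc
  obtain ⟨c1, c2, c3⟩ := a2.isArc
  exact ⟨⟨b1, by omega, c3⟩, by omega⟩

lemma unionArcs_not_topArc {p : ℕ × ℕ} (hp : p ∈ unionArcs N s) : ¬TopArc N s p.1 p.2 := by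
  rintro ⟨x, y, -, hxy, hX, -⟩
  exact h.unionArcs_uncrossed hp hxy hX

/-- Where an arc that is not a top arc is found near the spoke `k`. -/
def MissingAt (N : ℕ) (s : ℕ → ℕ → ℕ → Prop) (k x y : ℕ) : Prop :=
  IsArc N x y ∧ ¬TopArc N s x y ∧ ShortAt N s k x y ∧
    ((Peak N s (k + 1) ∧ k ≤ x + 1 ∧ x ≤ k + 1) ∨ (Peak N s (k - 1) ∧ k ≤ x + 2 ∧ x ≤ k) ∨
      (Peak N s k ∧ x = k ∧ y = k + 1))

omit h in
lemma ShortAt.cases {k x y : ℕ} (hs : ShortAt N s k x y) :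
    y = x + 1 ∨ (x + 1 = k ∧ y = k + 1) := by
  rcases hs with hs | ⟨h1, h2, -⟩
  · exact Or.inl hs
  · exact Or.inr ⟨h1, h2⟩

/-- Missing arcs stay near their spokes, so only spokes at distance at most three could share one.
These distances are excluded by the restrictions on nearby once-crossed spokes and by the absence of
consecutive peaks. -/
lemma missingAt_ne {k k' x y : ℕ} (hk : OneSpoke N s k) (hk' : OneSpoke N s k') (hlt : k < k')
    (hm : MissingAt N s k x y) : ¬MissingAt N s k' x y := by
  rintro ⟨-, -, a1, a2⟩
  obtain ⟨-, -, b1, b2⟩ := hm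
  have e1 : k' ≠ k + 1 := by
    rintro rfl
    exact h.not_oneSpoke_succ hk hk'
  have e2 : k' = k + 2 → ¬Peak N s (k + 1) := by
    rintro rfl hp
    exact h.not_oneSpoke_peak_oneSpoke hk hp hk'
  have e3 : ∀ m, Peak N s m → ¬Peak N s (m + 1) := fun m hm => not_peak_succ hm
  have c1 := a1.cases
  have c2 := b1.cases
  have bd := hk.bounds
  rcases b2 with ⟨p1, p2, p3⟩ | ⟨p1, p2, p3⟩ | ⟨p1, p2, p3⟩ <;>
    rcases a2 with ⟨q1, q2, q3⟩ | ⟨q1, q2, q3⟩ | ⟨q1, q2, q3⟩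
  · exact e2 (by omega) p1
  · rcases (by omega : k' = k + 2 ∨ k' = k + 3) with rfl | rfl
    · exact e2 rfl p1
    · exact e3 _ p1 q1
  · omega
  · omega
  · obtain rfl : k' = k + 2 := by omega
    exact e2 rfl q1
  · omega
  · omega
  · obtain rfl : k' = k + 2 := by omega
    exact e3 _ p1 q1
  · omega

end SpokeSystem

namespace SpokeSystem

variable {N : ℕ} {s : ℕ → ℕ → ℕ → Prop}

/-- The spokes that are crossed once, are not peaks, and are next to a peak. -/
noncomputable def besidePeaks (N : ℕ) (s : ℕ → ℕ → ℕ → Prop) : Finset ℕ :=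
  open Classical in
  (oneSpokes N s).filter (fun k => ¬Peak N s k ∧ (Peak N s (k + 1) ∨ Peak N s (k - 1)))

/-- The spokes beside peaks that are near the ends. -/
noncomputable def endSpokes (N : ℕ) (s : ℕ → ℕ → ℕ → Prop) : Finset ℕ :=
  open Classical in
  (besidePeaks N s).filter
    (fun k => ¬(Peak N s (k + 1) ∧ k + 5 ≤ N) ∧ ¬(Peak N s (k - 1) ∧ 6 ≤ k))

lemma mem_besidePeaks {k : ℕ} : k ∈ besidePeaks N s ↔
    OneSpoke N s k ∧ ¬Peak N s k ∧ (Peak N s (k + 1) ∨ Peak N s (k - 1)) := by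
  simp only [besidePeaks, Finset.mem_filter, mem_oneSpokes]

lemma card_endSpokes_le : (endSpokes N s).card ≤ 6 := by
  have hsub : endSpokes N s ⊆ Finset.Icc 3 5 ∪ Finset.Icc (N - 4) (N - 2) := by
    intro k hk
    simp only [endSpokes, Finset.mem_filter, mem_besidePeaks] at hk
    obtain ⟨⟨-, -, h1⟩, h2, h3⟩ := hk
    simp only [Finset.mem_union, Finset.mem_Icc]
    rcases h1 with h1 | h1
    · have := h1.bounds
      have : ¬ k + 5 ≤ N := fun hc => h2 ⟨h1, hc⟩
      omega
    · have := h1.bounds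
      have : ¬ 6 ≤ k := fun hc => h3 ⟨h1, hc⟩
      omega
  have h1 := (Finset.card_le_card hsub).trans (Finset.card_union_le _ _)
  simp only [Nat.card_Icc] at h1
  omega

variable (h : SpokeSystem N s)
include h

lemma exists_missingAt {k : ℕ}
    (hk : k ∈ (besidePeaks N s \ endSpokes N s) ∪ (oneSpokes N s ∩ peaks N s)) :
    OneSpoke N s k ∧ ∃ p : ℕ × ℕ, MissingAt N s k p.1 p.2 := by
  simp only [Finset.mem_union, Finset.mem_sdiff, Finset.mem_inter, mem_oneSpokes, mem_peaks] at hk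
  rcases hk with ⟨h1, h2⟩ | ⟨h1, h2⟩
  · simp only [endSpokes, Finset.mem_filter, h1, true_and] at h2
    obtain ⟨h1, -, -⟩ := mem_besidePeaks.1 h1
    refine ⟨h1, ?_⟩
    by_cases hc : Peak N s (k + 1) ∧ k + 5 ≤ N
    · obtain ⟨x, y, a, b, c, d⟩ := h.exists_missing_right h1 hc.1 hc.2
      exact ⟨(x, y), a, b, c, Or.inl ⟨hc.1, d⟩⟩
    · have hc' : Peak N s (k - 1) ∧ 6 ≤ k := by tauto
      obtain ⟨x, y, a, b, c, d⟩ := h.exists_missing_left h1 hc'.1 hc'.2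
      exact ⟨(x, y), a, b, c, Or.inr (Or.inl ⟨hc'.1, d⟩)⟩
  · have := h1.bounds
    exact ⟨h1, (k, k + 1), ⟨by omega, by omega, by omega⟩, h.not_topArc_of_peak h1 h2,
      Or.inl rfl, Or.inr (Or.inr ⟨h2, rfl, rfl⟩)⟩

/-- Replace each right arc by a spanning arc and add one missing arc for each spoke in W. The
replacement loses no members, the three kinds are disjoint, and no two arcs interlace. -/
lemma card_topArcs_add_le :
    (topArcs N s).card + ((besidePeaks N s \ endSpokes N s) ∪ (oneSpokes N s ∩ peaks N s)).card
      ≤ 2 * (N - 1) := by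
  classical
  set W := (besidePeaks N s \ endSpokes N s) ∪ (oneSpokes N s ∩ peaks N s) with hW
  have hex := fun k (hk : k ∈ W) => h.exists_missingAt hk
  choose! h1 f hf using hex
  have hinj : Set.InjOn f W := by
    intro k hk k' hk' hkk
    by_contra hne
    have a := hf k hk
    have b := hf k' hk'
    rw [hkk] at a
    rcases lt_or_gt_of_ne hne with hlt | hgt
    · exact h.missingAt_ne (h1 k hk) (h1 k' hk') hlt a b
    · exact h.missingAt_ne (h1 k' hk') (h1 k hk) hgt b a
  have c1 : (W.image f).card = W.card := Finset.card_image_of_injOn hinj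
  have c2 : (rightArcs N s).card ≤ (unionArcs N s).card := card_rightArcs_le
  have c3 : (topArcs N s \ rightArcs N s).card + (rightArcs N s).card = (topArcs N s).card :=
    Finset.card_sdiff_add_card_eq_card (Finset.filter_subset _ _)
  have d1 : Disjoint (topArcs N s \ rightArcs N s) (unionArcs N s) := by
    rw [Finset.disjoint_left]
    intro p hp hp'
    exact h.unionArcs_not_topArc hp' (mem_topArcs.1 (Finset.mem_sdiff.1 hp).1)
  have d2 : Disjoint ((topArcs N s \ rightArcs N s) ∪ unionArcs N s) (W.image f) := by
    rw [Finset.disjoint_left]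
    intro p hp hp'
    obtain ⟨k, hk, rfl⟩ := Finset.mem_image.1 hp'
    rcases Finset.mem_union.1 hp with hp | hp
    · exact (hf k hk).2.1 (mem_topArcs.1 (Finset.mem_sdiff.1 hp).1)
    · have := (unionArcs_isArc hp).2
      have := (hf k hk).2.2.1.cases
      omega
  -- Both ends of p carry top arcs lying within p, of length at least two if p has. At the index k
  -- of a missing arc spanning k alone, `ShortAt` forbids exactly such arcs.
  have arcEnds : ∀ p ∈ (topArcs N s \ rightArcs N s) ∪ unionArcs N s,
      ∃ i j, TopArc N s p.1 j ∧ TopArc N s i p.2 ∧ p.1 ≤ i ∧ j ≤ p.2 ∧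
        (p.1 + 2 ≤ p.2 → p.1 + 2 ≤ j ∧ i + 2 ≤ p.2) := by
    intro p hp
    rcases Finset.mem_union.1 hp with hp | hp
    · have := mem_topArcs.1 (Finset.mem_sdiff.1 hp).1
      exact ⟨p.1, p.2, this, this, le_rfl, le_rfl, fun h => ⟨h, h⟩⟩
    · obtain ⟨j, k, a1, a2, a3, a4, a5⟩ := mem_unionArcs.1 hp
      exact ⟨j, k, a1, a2, by omega, by omega, fun _ => ⟨by omega, by omega⟩⟩
  have long : ∀ p ∈ (topArcs N s \ rightArcs N s) ∪ unionArcs N s, ∀ k ∈ W,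
      ¬(p.1 < (f k).1 ∧ (f k).1 < p.2 ∧ p.2 < (f k).2) ∧
      ¬((f k).1 < p.1 ∧ p.1 < (f k).2 ∧ (f k).2 < p.2) := by
    intro p hp k hk
    obtain ⟨i, j, a1, a2, a3, a4, a5⟩ := arcEnds p hp
    rcases (hf k hk).2.2.1 with b | ⟨b1, b2, b3, b4⟩
    · omega
    · constructor
      · intro hc
        have : p.2 = k := by omega
        exact b4 i (by omega) (this ▸ a2)
      · intro hc
        have : p.1 = k := by omega
        exact b3 j (by omega) (this ▸ a1)
  have key : ((topArcs N s \ rightArcs N s) ∪ unionArcs N s ∪ W.image f).card ≤ 2 * (N - 1) := by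
    apply card_le_of_not_interlace
    · intro p hp
      simp only [Finset.mem_union, Finset.mem_sdiff, Finset.mem_image, mem_topArcs] at hp
      rcases hp with (hp | hp) | ⟨k, hk, rfl⟩
      · exact hp.1.isArc
      · exact (unionArcs_isArc hp).1
      · exact (hf k hk).1
    · intro p hp q hq hpq
      obtain ⟨q1, q2, q3⟩ := id hpq
      rcases Finset.mem_union.1 hp with hp | hp <;> rcases Finset.mem_union.1 hq with hq | hq
      · rcases Finset.mem_union.1 hp with hp | hp <;> rcases Finset.mem_union.1 hq with hq | hq
        · obtain ⟨a1, a2⟩ := Finset.mem_sdiff.1 hp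
          obtain ⟨b1, b2⟩ := Finset.mem_sdiff.1 hq
          exact b2 (mem_rightArcs.2 ⟨mem_topArcs.1 b1, p.1, p.2, mem_topArcs.1 a1, hpq⟩)
        · have a := mem_topArcs.1 (Finset.mem_sdiff.1 hp).1
          have b := h.unionArcs_below hq q2 q3
          have c := a.below q1 q2
          exact h.unionArcs_uncrossed hq a.isArc (Or.inr (Or.inl ⟨q1, q2, q3, by tauto⟩))
        · have a := mem_topArcs.1 (Finset.mem_sdiff.1 hq).1
          have b := h.unionArcs_below hp q1 q2
          have c := a.below q2 q3
          exact h.unionArcs_uncrossed hp a.isArc (Or.inl ⟨q1, q2, q3, by tauto⟩)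
        · have b := h.unionArcs_below hp q1 q2
          have c := h.unionArcs_below hq q2 q3
          exact h.unionArcs_uncrossed hp (unionArcs_isArc hq).1
            (Or.inl ⟨q1, q2, q3, by tauto⟩)
      · obtain ⟨k, hk, rfl⟩ := Finset.mem_image.1 hq
        exact (long p hp k hk).1 hpq
      · obtain ⟨k, hk, rfl⟩ := Finset.mem_image.1 hp
        exact (long q hq k hk).2 hpq
      · obtain ⟨k, hk, rfl⟩ := Finset.mem_image.1 hp
        obtain ⟨k', hk', rfl⟩ := Finset.mem_image.1 hq
        have a := (hf k hk).2.2.1.cases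
        have b := (hf k' hk').2.2.1.cases
        -- Arcs between neighbours never interlace, so both missing arcs have length two and belong
        -- to consecutive spokes.
        obtain rfl : k' = k + 1 := by omega
        exact h.not_oneSpoke_succ (h1 k hk) (h1 _ hk')
  rw [Finset.card_union_of_disjoint d2, Finset.card_union_of_disjoint d1, c1] at key
  omega

/-- The number of edges that are crossed exactly once, counted by kind. -/
theorem card_le : (oneSpokes N s).card + (peaks N s).card + (topArcs N s).card ≤
    (N + 1) / 2 + 6 + 2 * (N - 1) := by
  classical
  have key := h.card_topArcs_add_le
  have e1 : (oneSpokes N s ∪ peaks N s).card + (oneSpokes N s ∩ peaks N s).card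
      = (oneSpokes N s).card + (peaks N s).card := Finset.card_union_add_card_inter _ _
  have hB : besidePeaks N s ⊆ oneSpokes N s ∪ peaks N s := fun k hk =>
    Finset.mem_union_left _ (mem_oneSpokes.2 (mem_besidePeaks.1 hk).1)
  have e2 : ((oneSpokes N s ∪ peaks N s) \ besidePeaks N s).card + (besidePeaks N s).card
      = (oneSpokes N s ∪ peaks N s).card := Finset.card_sdiff_add_card_eq_card hB
  have e3 : (besidePeaks N s \ endSpokes N s).card + (endSpokes N s).card
      = (besidePeaks N s).card := by
    unfold endSpokes
    exact Finset.card_sdiff_add_card_eq_card (Finset.filter_subset _ _)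
  have e4 : Disjoint (besidePeaks N s \ endSpokes N s) (oneSpokes N s ∩ peaks N s) := by
    rw [Finset.disjoint_left]
    intro k hk hk'
    exact (mem_besidePeaks.1 (Finset.mem_sdiff.1 hk).1).2.1
      (mem_peaks.1 (Finset.mem_inter.1 hk').2)
  rw [Finset.card_union_of_disjoint e4] at key
  have e5 : (endSpokes N s).card ≤ 6 := card_endSpokes_le
  have e6 : ((oneSpokes N s ∪ peaks N s) \ besidePeaks N s).card ≤ (N + 1) / 2 := by
    -- Consecutive survivors would be two once-crossed spokes, two peaks, or a peak next to a
    -- once-crossed spoke that should have been discarded.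
    apply card_le_of_not_consecutive
    · intro k hk
      simp only [Finset.mem_sdiff, Finset.mem_union, mem_oneSpokes, mem_peaks] at hk
      rcases hk.1 with hk | hk <;> have := hk.bounds <;> omega
    · intro k hk hk'
      simp only [Finset.mem_sdiff, Finset.mem_union, mem_oneSpokes, mem_peaks,
        mem_besidePeaks, Nat.add_sub_cancel] at hk hk'
      have n1 : Peak N s k → ¬Peak N s (k + 1) := not_peak_succ
      have n2 : OneSpoke N s k → ¬OneSpoke N s (k + 1) := h.not_oneSpoke_succ
      tauto
  omega

end SpokeSystem

/-! ### Crossing points and crossing edges. -/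

/-- The edge `ab` is crossed by `cd` and by no other edge, in the drawing of the complete graph with
vertices at `P`. -/
def OnlyCrosser {V : Type*} (P : V → Plane) (a b c d : V) : Prop :=
  SegCross (P a) (P b) (P c) (P d) ∧
    ∀ x y, SegCross (P a) (P b) (P x) (P y) → s(x, y) = s(c, d)

lemma genPos_iff {V : Type*} {P : V → Plane} : GenPos P ↔ ∀ u v w : V, u ≠ v → u ≠ w → v ≠ w →
    ¬ Collinear ℝ ({P u, P v, P w} : Set Plane) := by
  simp only [GenPos, collinear_iff_orient, ne_eq]

@[simp] lemma edgeInterior_mk {V : Type*} (P : V → Plane) (a b : V) :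
    edgeInterior P s(a, b) = openSegment ℝ (P a) (P b) := rfl

lemma GenPos.inter_nonempty_iff {V : Type*} {P : V → Plane} (hP : GenPos P) {a b c d : V}
    (hab : a ≠ b) (hcd : c ≠ d) (hne : s(c, d) ≠ s(a, b)) :
    (edgeInterior P s(a, b) ∩ edgeInterior P s(c, d)).Nonempty ↔
      SegCross (P a) (P b) (P c) (P d) := by
  rw [edgeInterior_mk, edgeInterior_mk]
  have common : ∀ a b c : V, a ≠ b → a ≠ c → b ≠ c →
      openSegment ℝ (P a) (P b) ∩ openSegment ℝ (P a) (P c) = ∅ :=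
    fun a b c h1 h2 h3 => openSegment_inter_of_common (hP a b c h1 h2 h3)
  constructor
  · intro h
    rcases eq_or_ne a c with rfl | hac
    · rw [common a b d hab hcd (by rintro rfl; exact hne rfl)] at h
      exact absurd h Set.not_nonempty_empty
    rcases eq_or_ne a d with rfl | had
    · rw [openSegment_symm ℝ (P c), common a b c hab hac
        (by rintro rfl; exact hne Sym2.eq_swap)] at h
      exact absurd h Set.not_nonempty_empty
    rcases eq_or_ne b c with rfl | hbc
    · rw [openSegment_symm ℝ (P a), common b a d hab.symm hcd had] at h
      exact absurd h Set.not_nonempty_empty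
    rcases eq_or_ne b d with rfl | hbd
    · rw [openSegment_symm ℝ (P a), openSegment_symm ℝ (P c), common b a c hab.symm hbc hac] at h
      exact absurd h Set.not_nonempty_empty
    exact (openSegment_inter_nonempty_iff (hP a b c hab hac hbc)).1 h
  · intro h
    obtain ⟨-, -, hac, had, hbc, hbd⟩ := GenPos.ne_of_segCross h
    exact (openSegment_inter_nonempty_iff (hP a b c hab hac hbc)).2 h

lemma GenPos.edge_ne_of_segCross {V : Type*} {P : V → Plane} {a b c d : V}
    (h : SegCross (P a) (P b) (P c) (P d)) : s(c, d) ≠ s(a, b) := by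
  obtain ⟨-, -, hac, had, hbc, hbd⟩ := GenPos.ne_of_segCross h
  rw [Ne, Sym2.eq_iff]
  tauto

namespace RectilinearDrawing

variable {V : Type*}

lemma genPos {G : SimpleGraph V} (D : RectilinearDrawing G) : GenPos D.pos :=
  genPos_iff.2 D.general_position

/-- Crossings are points and crossers are edges. They correspond because two edges meet in at most
one interior point and no three edges share one. -/
lemma mem_crossingSet_one_iff (D : RectilinearDrawing (⊤ : SimpleGraph V)) {a b : V} :
    s(a, b) ∈ D.crossingSet 1 ↔ a ≠ b ∧ ∃ c d, OnlyCrosser D.pos a b c d := by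
  have hP := D.genPos
  simp only [crossingSet, Set.mem_ofPred_eq, SimpleGraph.mem_edgeSet, SimpleGraph.top_adj,
    Nat.cast_one]
  refine and_congr_right fun hab => ?_
  rw [Set.encard_eq_one]
  have edge : ∀ {c d : V}, c ≠ d → s(c, d) ∈ (⊤ : SimpleGraph V).edgeSet := by
    intro c d h
    simpa using h
  constructor
  · rintro ⟨x, hx⟩
    have hx' : x ∈ D.crossingsOn s(a, b) := by rw [hx]; rfl
    obtain ⟨hxe, f, hf, hfe, hxf⟩ := hx'
    induction f using Sym2.ind with
    | _ c d =>
    have hcd : c ≠ d := by simpa using hf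
    refine ⟨c, d, (hP.inter_nonempty_iff hab hcd hfe).1 ⟨x, hxe, hxf⟩, fun u v huv => ?_⟩
    by_contra hne
    have huv' := (GenPos.ne_of_segCross huv).2.1
    have hne' := GenPos.edge_ne_of_segCross huv
    obtain ⟨y, hye, hyg⟩ := (hP.inter_nonempty_iff hab huv' hne').2 huv
    have hy : y ∈ D.crossingsOn s(a, b) := ⟨hye, s(u, v), edge huv', hne', hyg⟩
    rw [hx, Set.mem_singleton_iff] at hy
    subst hy
    have := D.no_three_edges s(a, b) (edge hab) s(c, d) hf s(u, v) (edge huv') hfe.symm hne'.symm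
      (Ne.symm hne)
    exact Set.notMem_empty y (this ▸ ⟨⟨hxe, hxf⟩, hyg⟩)
  · rintro ⟨c, d, h, hu⟩
    obtain ⟨-, hcd, hac, had, hbc, hbd⟩ := GenPos.ne_of_segCross h
    have hne := GenPos.edge_ne_of_segCross h
    obtain ⟨x, hx1, hx2⟩ := (hP.inter_nonempty_iff hab hcd hne).2 h
    refine ⟨x, Set.eq_singleton_iff_unique_mem.2 ⟨⟨hx1, s(c, d), edge hcd, hne, hx2⟩, ?_⟩⟩
    rintro y ⟨hy1, f, hf, hfe, hyf⟩
    induction f using Sym2.ind with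
    | _ u v =>
    have huv : u ≠ v := by simpa using hf
    have := hu u v ((hP.inter_nonempty_iff hab huv hfe).1 ⟨y, hy1, hyf⟩)
    rw [this] at hyf
    exact openSegment_inter_subsingleton (hP a b c hab hac hbc) ⟨hy1, hyf⟩ ⟨hx1, hx2⟩

end RectilinearDrawing

/-! ### The hub labelling of a drawing and its spoke system. -/

/-- Labels of points, sorted by the angle around the point labelled `0`. -/
structure HubLabelling {N : ℕ} (P : Fin (N + 1) → Plane) (L : ℕ → Fin (N + 1)) : Prop where
  injOn : ∀ i j, i ≤ N → j ≤ N → L i = L j → i = j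
  surj : ∀ v, ∃ i ≤ N, L i = v
  hub : ∀ i j, 1 ≤ i → i < j → j ≤ N → 0 < orient (P (L 0)) (P (L i)) (P (L j))

/-- The point p farthest from the origin is extreme: g > 0 says that every other point is strictly
on the inner side of the tangent at p to the circle through p centred at the origin. On that
half-plane t / g is the tangent of the angle at p, so sorting by it sorts by angle. -/
lemma exists_hubLabelling {N : ℕ} {P : Fin (N + 1) → Plane} (hP : GenPos P)
    (hinj : Function.Injective P) : ∃ L, HubLabelling P L := by
  obtain ⟨p, hp⟩ := Finite.exists_max (fun v => (P v 0) ^ 2 + (P v 1) ^ 2)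
  set g : Fin (N + 1) → ℝ := fun b => P p 0 * (P p 0 - P b 0) + P p 1 * (P p 1 - P b 1) with hg
  set t : Fin (N + 1) → ℝ := fun b => P p 1 * (P b 0 - P p 0) - P p 0 * (P b 1 - P p 1) with ht
  have gpos : ∀ b, b ≠ p → 0 < g b := by
    intro b hb
    have h1 := hp b
    have h2 : 0 < (P p 0 - P b 0) ^ 2 + (P p 1 - P b 1) ^ 2 := by
      by_contra hc
      apply hb
      apply hinj
      have e0 : (P p 0 - P b 0) ^ 2 = 0 := by
        nlinarith [sq_nonneg (P p 0 - P b 0), sq_nonneg (P p 1 - P b 1)]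
      have e1 : (P p 1 - P b 1) ^ 2 = 0 := by
        nlinarith [sq_nonneg (P p 0 - P b 0), sq_nonneg (P p 1 - P b 1)]
      exact plane_ext (sub_eq_zero.1 (pow_eq_zero_iff two_ne_zero |>.1 e0)).symm
        (sub_eq_zero.1 (pow_eq_zero_iff two_ne_zero |>.1 e1)).symm
    simp only [hg]
    nlinarith
  have key : ∀ a b, g a * t b - t a * g b
      = ((P p 0) ^ 2 + (P p 1) ^ 2) * orient (P p) (P a) (P b) := by
    intro a b
    simp only [hg, ht, orient]
    ring
  have lt_iff : ∀ a b, a ≠ p → b ≠ p → t a / g a < t b / g b →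
      0 < orient (P p) (P a) (P b) := by
    intro a b ha hb hab
    rw [div_lt_div_iff₀ (gpos a ha) (gpos b hb)] at hab
    have : 0 < ((P p 0) ^ 2 + (P p 1) ^ 2) * orient (P p) (P a) (P b) := by
      rw [← key]; linarith
    exact pos_of_mul_pos_right this (by positivity)
  have ne_of : ∀ a b, a ≠ p → b ≠ p → a ≠ b → t a / g a ≠ t b / g b := by
    intro a b ha hb hab he
    rw [div_eq_div_iff (gpos a ha).ne' (gpos b hb).ne'] at he
    have h0 : ((P p 0) ^ 2 + (P p 1) ^ 2) * orient (P p) (P a) (P b) = 0 := by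
      rw [← key]; linarith
    rcases mul_eq_zero.1 h0 with h0 | h0
    · have := gpos a ha
      have e0 : P p 0 = 0 := by nlinarith [sq_nonneg (P p 0), sq_nonneg (P p 1)]
      have e1 : P p 1 = 0 := by nlinarith [sq_nonneg (P p 0), sq_nonneg (P p 1)]
      simp [hg, e0, e1] at this
    · exact hP p a b (Ne.symm ha) (Ne.symm hb) hab h0
  classical
  -- The value ⊥ places the hub first, giving it the label 0.
  set f : Fin (N + 1) → WithBot ℝ := fun b => if b = p then ⊥ else ((t b / g b : ℝ) : WithBot ℝ)
    with hf
  have fp : f p = ⊥ := by simp [hf]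
  have fn : ∀ b, b ≠ p → f b = ((t b / g b : ℝ) : WithBot ℝ) := fun b hb => by simp [hf, hb]
  have finj : Function.Injective f := by
    intro a b hab
    by_contra hne
    rcases eq_or_ne a p with rfl | ha
    · rw [fp, fn b (Ne.symm hne)] at hab
      exact WithBot.coe_ne_bot hab.symm
    rcases eq_or_ne b p with rfl | hb
    · rw [fp, fn a hne] at hab
      exact WithBot.coe_ne_bot hab
    rw [fn a ha, fn b hb, WithBot.coe_inj] at hab
    exact ne_of a b ha hb hne hab
  set σ := Tuple.sort f with hσ
  have hmono : StrictMono (f ∘ σ) :=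
    (Tuple.monotone_sort f).strictMono_of_injective (finj.comp σ.injective)
  have h0 : σ 0 = p := by
    obtain ⟨j, hj⟩ := σ.surjective p
    have := hmono.monotone (Fin.zero_le j)
    simp only [Function.comp, hj, fp, le_bot_iff] at this
    exact finj (this.trans fp.symm)
  have hval : ∀ i, i ≤ N → ((Fin.ofNat (N + 1) i : Fin (N + 1)) : ℕ) = i := by
    intro i hi
    simp only [Fin.val_ofNat]
    exact Nat.mod_eq_of_lt (by omega)
  refine ⟨fun i => σ (Fin.ofNat (N + 1) i), ?_, ?_, ?_⟩
  · intro i j hi hj hij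
    have := congrArg Fin.val (σ.injective hij)
    rwa [hval i hi, hval j hj] at this
  · intro v
    obtain ⟨j, hj⟩ := σ.surjective v
    refine ⟨j, by omega, ?_⟩
    rw [← hj]
    congr 1
    exact Fin.ext (hval j (by omega))
  · intro i j hi hij hj
    have e0 : (Fin.ofNat (N + 1) 0 : Fin (N + 1)) = 0 := rfl
    simp only [e0, h0]
    have hne : ∀ i, 1 ≤ i → i ≤ N → σ (Fin.ofNat (N + 1) i) ≠ p := by
      intro i h1 h2 h3
      rw [← h0] at h3
      have := congrArg Fin.val (σ.injective h3)
      rw [hval i h2] at this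
      simp at this
      omega
    have hlt : (Fin.ofNat (N + 1) i : Fin (N + 1)) < Fin.ofNat (N + 1) j := by
      rw [Fin.lt_def, hval i (by omega), hval j hj]
      exact hij
    have := hmono hlt
    simp only [Function.comp] at this
    rw [fn _ (hne i hi (by omega)), fn _ (hne j (by omega) hj), WithBot.coe_lt_coe] at this
    exact lt_iff _ _ (hne i hi (by omega)) (hne j (by omega) hj) this

/-- The orientations of the labelled triples. -/
def triPos {N : ℕ} (P : Fin (N + 1) → Plane) (L : ℕ → Fin (N + 1)) (i j k : ℕ) : Prop :=
  0 < orient (P (L i)) (P (L j)) (P (L k))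

namespace HubLabelling

variable {N : ℕ} {P : Fin (N + 1) → Plane} {L : ℕ → Fin (N + 1)} (hL : HubLabelling P L)
  (hP : GenPos P)
include hL hP

lemma orient_ne {i j k : ℕ} (h1 : i < j) (h2 : j < k) (h3 : k ≤ N) :
    orient (P (L i)) (P (L j)) (P (L k)) ≠ 0 := by
  apply hP <;> intro hc
  · have := hL.injOn i j (by omega) (by omega) hc
    omega
  · have := hL.injOn i k (by omega) (by omega) hc
    omega
  · have := hL.injOn j k (by omega) (by omega) hc
    omega

omit hP in
lemma triPos_zero {i j : ℕ} (h1 : 1 ≤ i) (h2 : i < j) (h3 : j ≤ N) : triPos P L 0 i j :=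
  hL.hub i j h1 h2 h3

omit hP in
lemma signMono {a b c d : ℕ} (h1 : a < b) (h2 : b < c) (h3 : c < d) (h4 : d ≤ N) :
    SignMono (P (L a)) (P (L b)) (P (L c)) (P (L d)) := by
  rcases Nat.eq_zero_or_pos a with rfl | ha
  · exact signMono_of_pos (hL.hub _ _ (by omega) (by omega) (by omega))
      (hL.hub _ _ (by omega) (by omega) (by omega)) (hL.hub _ _ (by omega) (by omega) (by omega))
  · exact signMono_of_hub (hL.hub _ _ (by omega) (by omega) (by omega))
      (hL.hub _ _ (by omega) (by omega) (by omega)) (hL.hub _ _ (by omega) (by omega) (by omega))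
      (hL.hub _ _ (by omega) (by omega) (by omega)) (hL.hub _ _ (by omega) (by omega) (by omega))
      (hL.hub _ _ (by omega) (by omega) (by omega))

lemma segCross_alternate {a b c d : ℕ} (h1 : a < b) (h2 : b < c) (h3 : c < d) (h4 : d ≤ N) :
    SegCross (P (L a)) (P (L c)) (P (L b)) (P (L d)) ↔ (triPos P L a b c ↔ triPos P L b c d) :=
  segCross_iff_alternate (hL.orient_ne hP h1 h2 (by omega))
    (hL.orient_ne hP h1 (by omega) (by omega)) (hL.orient_ne hP (by omega) h3 h4)
    (hL.orient_ne hP h2 h3 h4) (hL.signMono h1 h2 h3 h4)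

lemma segCross_nested {a b c d : ℕ} (h1 : a < b) (h2 : b < c) (h3 : c < d) (h4 : d ≤ N) :
    SegCross (P (L a)) (P (L d)) (P (L b)) (P (L c)) ↔ ¬(triPos P L a b d ↔ triPos P L a c d) :=
  segCross_iff_nested (hL.orient_ne hP h1 h2 (by omega))
    (hL.orient_ne hP h1 (by omega) (by omega)) (hL.orient_ne hP (by omega) h3 h4)
    (hL.orient_ne hP h2 h3 h4) (hL.signMono h1 h2 h3 h4)

lemma not_segCross_separated {a b c d : ℕ} (h1 : a < b) (h2 : b < c) (h3 : c < d) (h4 : d ≤ N) :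
    ¬SegCross (P (L a)) (P (L b)) (P (L c)) (P (L d)) :=
  not_segCross_of_separated (hL.orient_ne hP h1 h2 (by omega))
    (hL.orient_ne hP h1 (by omega) (by omega)) (hL.orient_ne hP (by omega) h3 h4)
    (hL.orient_ne hP h2 h3 h4) (hL.signMono h1 h2 h3 h4)

lemma segCross_iff {i j k l : ℕ} (hij : i < j) (hj : j ≤ N) (hkl : k < l) (hl : l ≤ N) :
    SegCross (P (L i)) (P (L j)) (P (L k)) (P (L l)) ↔ ArcCross (triPos P L) i j k l := by
  have hne := GenPos.ne_of_segCross (P := fun i => P (L i)) (a := i) (b := j) (c := k) (d := l)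
  constructor
  · intro h
    obtain ⟨-, -, hik, hil, hjk, hjl⟩ := hne h
    rcases lt_or_gt_of_ne hik with h1 | h1
    · rcases lt_or_gt_of_ne hjk with h2 | h2
      · exact absurd h (hL.not_segCross_separated hP hij h2 hkl hl)
      · rcases lt_or_gt_of_ne hjl with h3 | h3
        · exact Or.inl ⟨h1, h2, h3, (hL.segCross_alternate hP h1 h2 h3 hl).1 h⟩
        · exact Or.inr (Or.inr (Or.inl ⟨h1, h3, (hL.segCross_nested hP h1 hkl h3 hj).1 h⟩))
    · rw [segCross_symm] at h
      rcases lt_or_gt_of_ne hil with h2 | h2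
      · rcases lt_or_gt_of_ne hjl with h3 | h3
        · exact Or.inr (Or.inr (Or.inr ⟨h1, h3, (hL.segCross_nested hP h1 hij h3 hl).1 h⟩))
        · exact Or.inr (Or.inl ⟨h1, h2, h3, (hL.segCross_alternate hP h1 h2 h3 hj).1 h⟩)
      · exact absurd h (hL.not_segCross_separated hP hkl h2 hij hj)
  · rintro (⟨h1, h2, h3, h⟩ | ⟨h1, h2, h3, h⟩ | ⟨h1, h3, h⟩ | ⟨h1, h3, h⟩)
    · exact (hL.segCross_alternate hP h1 h2 h3 hl).2 h
    · exact segCross_symm.1 ((hL.segCross_alternate hP h1 h2 h3 hj).2 h)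
    · exact (hL.segCross_nested hP h1 hkl h3 hj).2 h
    · exact segCross_symm.1 ((hL.segCross_nested hP h1 hij h3 hl).2 h)

omit hP in
lemma arcCross_spoke {k x y : ℕ} (_ : 1 ≤ k) (hkN : k ≤ N) (hxy : x < y) (_ : y ≤ N) :
    ArcCross (triPos P L) 0 k x y ↔ 1 ≤ x ∧ SpokeCross (triPos P L) k x y := by
  have t := fun i j => hL.triPos_zero (i := i) (j := j)
  constructor
  · rintro (⟨h1, h2, h3, h⟩ | ⟨h1, h2, h3, h⟩ | ⟨h1, h3, h⟩ | ⟨h1, h3, h⟩)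
    · exact ⟨h1, h2, h3, h.1 (t _ _ (by omega) (by omega) (by omega))⟩
    · omega
    · exact absurd (iff_of_true (t _ _ (by omega) (by omega) (by omega))
        (t _ _ (by omega) (by omega) (by omega))) h
    · omega
  · rintro ⟨h0, h1, h2, h⟩
    exact Or.inl ⟨h0, h1, h2, iff_of_true (t _ _ (by omega) (by omega) (by omega)) h⟩

omit hL hP in
lemma arcCross_symm {s : ℕ → ℕ → ℕ → Prop} {i j k l : ℕ} :
    ArcCross s i j k l ↔ ArcCross s k l i j := by
  unfold ArcCross
  constructor <;> rintro (h | h | h | h) <;> simp [h]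

omit hP in
lemma exists_labels {u v : Fin (N + 1)} (huv : u ≠ v) :
    ∃ i j, i < j ∧ j ≤ N ∧ s(u, v) = s(L i, L j) := by
  obtain ⟨i, hi, rfl⟩ := hL.surj u
  obtain ⟨j, hj, rfl⟩ := hL.surj v
  rcases lt_or_gt_of_ne (fun h : i = j => huv (by rw [h])) with h | h
  · exact ⟨i, j, h, hj, rfl⟩
  · exact ⟨j, i, h, hi, Sym2.eq_swap⟩

omit hP in
lemma mk_eq_iff {i j k l : ℕ} (hij : i < j) (hj : j ≤ N) (hkl : k < l) (hl : l ≤ N) :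
    s(L i, L j) = s(L k, L l) ↔ i = k ∧ j = l := by
  constructor
  · intro h
    rcases Sym2.eq_iff.1 h with ⟨h1, h2⟩ | ⟨h1, h2⟩
    · exact ⟨hL.injOn _ _ (by omega) (by omega) h1, hL.injOn _ _ (by omega) (by omega) h2⟩
    · have := hL.injOn _ _ (by omega) (by omega) h1
      have := hL.injOn _ _ (by omega) (by omega) h2
      omega
  · rintro ⟨rfl, rfl⟩
    rfl

omit hL hP in
lemma segCross_congr_right {a b c d c' d' : Fin (N + 1)} (h : s(c, d) = s(c', d')) :
    SegCross (P a) (P b) (P c) (P d) ↔ SegCross (P a) (P b) (P c') (P d') := by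
  rcases Sym2.eq_iff.1 h with ⟨rfl, rfl⟩ | ⟨rfl, rfl⟩
  · rfl
  · exact segCross_swap_right

lemma onlyCrosser_iff {i j k l : ℕ} (hij : i < j) (hj : j ≤ N) (hkl : k < l) (hl : l ≤ N) :
    OnlyCrosser P (L i) (L j) (L k) (L l) ↔ ArcCross (triPos P L) i j k l ∧
      ∀ x y, x < y → y ≤ N → ArcCross (triPos P L) i j x y → x = k ∧ y = l := by
  unfold OnlyCrosser
  rw [hL.segCross_iff hP hij hj hkl hl]
  refine and_congr_right fun _ => ⟨fun h x y hxy hy hX => ?_, fun h u v huv => ?_⟩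
  · exact (hL.mk_eq_iff hxy hy hkl hl).1 (h _ _ ((hL.segCross_iff hP hij hj hxy hy).2 hX))
  · obtain ⟨x, y, hxy, hy, he⟩ := hL.exists_labels (GenPos.ne_of_segCross huv).2.1
    rw [segCross_congr_right he, hL.segCross_iff hP hij hj hxy hy] at huv
    obtain ⟨rfl, rfl⟩ := h x y hxy hy huv
    exact he

lemma onlyCrosser_of_spokeOnlyArc {k d c : ℕ} (h : SpokeOnlyArc N (triPos P L) k d c) :
    OnlyCrosser P (L 0) (L k) (L d) (L c) := by
  obtain ⟨⟨a1, a2, a3⟩, hs, hu⟩ := h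
  obtain ⟨b1, b2, -⟩ := id hs
  rw [hL.onlyCrosser_iff hP (by omega) (by omega) a2 a3]
  refine ⟨(hL.arcCross_spoke (by omega) (by omega) a2 a3).2 ⟨a1, hs⟩, fun x y hxy hy hX => ?_⟩
  obtain ⟨h1, h2⟩ := (hL.arcCross_spoke (by omega) (by omega) hxy hy).1 hX
  exact hu x y ⟨h1, hxy, hy⟩ h2

lemma onlyCrosser_of_arcOnlyArc {i j k l : ℕ} (h : ArcOnlyArc N (triPos P L) i j k l) :
    OnlyCrosser P (L i) (L j) (L k) (L l) := by
  obtain ⟨⟨a1, a2, a3⟩, ⟨b1, b2, b3⟩, hX, hs, hu⟩ := h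
  rw [hL.onlyCrosser_iff hP a2 a3 b2 b3]
  refine ⟨hX, fun x y hxy hy hX => ?_⟩
  rcases Nat.eq_zero_or_pos x with rfl | hx
  · rw [arcCross_symm] at hX
    exact absurd ((hL.arcCross_spoke (by omega) hy a2 a3).1 hX).2 (hs y)
  · exact hu x y ⟨hx, hxy, hy⟩ hX

lemma onlyCrosser_of_arcOnlySpoke {i j k : ℕ} (h : ArcOnlySpoke N (triPos P L) i j k) :
    OnlyCrosser P (L i) (L j) (L 0) (L k) := by
  obtain ⟨⟨a1, a2, a3⟩, hs, hu, hn⟩ := h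
  obtain ⟨b1, b2, -⟩ := id hs
  rw [hL.onlyCrosser_iff hP a2 a3 (by omega) (by omega)]
  refine ⟨arcCross_symm.1 ((hL.arcCross_spoke (by omega) (by omega) a2 a3).2 ⟨a1, hs⟩),
    fun x y hxy hy hX => ?_⟩
  rcases Nat.eq_zero_or_pos x with rfl | hx
  · rw [arcCross_symm] at hX
    exact ⟨rfl, hu y ((hL.arcCross_spoke (by omega) hy a2 a3).1 hX).2⟩
  · exact absurd hX (hn x y ⟨hx, hxy, hy⟩)

lemma cases_of_onlyCrosser {i j : ℕ} (hij : i < j) (hj : j ≤ N) {c d : Fin (N + 1)}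
    (h : OnlyCrosser P (L i) (L j) c d) :
    (i = 0 ∧ SpokeSystem.OneSpoke N (triPos P L) j) ∨
      (1 ≤ i ∧ i + 2 = j ∧ SpokeSystem.Peak N (triPos P L) (i + 1)) ∨
      SpokeSystem.TopArc N (triPos P L) i j := by
  obtain ⟨k, l, hkl, hl, he⟩ := hL.exists_labels (GenPos.ne_of_segCross h.1).2.1
  have h' : OnlyCrosser P (L i) (L j) (L k) (L l) := by
    unfold OnlyCrosser at h ⊢
    rwa [← segCross_congr_right he, ← he]
  rw [hL.onlyCrosser_iff hP hij hj hkl hl] at h'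
  obtain ⟨hX, hu⟩ := h'
  have sp : ∀ m, 1 ≤ i → SpokeCross (triPos P L) m i j → ArcCross (triPos P L) i j 0 m := by
    intro m hi hm
    have h1 := hm.1
    have h2 := hm.2.1
    exact arcCross_symm.1 ((hL.arcCross_spoke (by omega) (by omega) hij hj).2 ⟨hi, hm⟩)
  rcases Nat.eq_zero_or_pos i with rfl | hi
  · obtain ⟨h1, h2⟩ := (hL.arcCross_spoke hij hj hkl hl).1 hX
    refine Or.inl ⟨rfl, k, l, ⟨h1, hkl, hl⟩, h2, fun x y ⟨a1, a2, a3⟩ hs => ?_⟩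
    exact hu x y a2 a3 ((hL.arcCross_spoke hij hj a2 a3).2 ⟨a1, hs⟩)
  rcases Nat.eq_zero_or_pos k with rfl | hk
  · rw [arcCross_symm] at hX
    obtain ⟨-, h2⟩ := (hL.arcCross_spoke hkl hl hij hj).1 hX
    have ha : ArcOnlySpoke N (triPos P L) i j l := by
      refine ⟨⟨hi, hij, hj⟩, h2, fun m hm => ?_, fun x y ⟨a1, a2, a3⟩ hx => ?_⟩
      · have h1 := hm.1
        have h2 := hm.2.1
        exact (hu 0 m (by omega) (by omega) (sp m hi hm)).2
      · have := (hu x y a2 a3 hx).1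
        omega
    obtain ⟨rfl, rfl⟩ := SpokeSystem.Peak.of_arcOnlySpoke ha
    exact Or.inr (Or.inl ⟨hi, rfl, ha⟩)
  · refine Or.inr (Or.inr ⟨k, l, ⟨hi, hij, hj⟩, ⟨hk, hkl, hl⟩, hX, fun m hm => ?_,
      fun x y ⟨a1, a2, a3⟩ hx => hu x y a2 a3 hx⟩)
    have h1 := hm.1
    have h2 := hm.2.1
    have := (hu 0 m (by omega) (by omega) (sp m hi hm)).1
    omega

lemma spokeSystem : SpokeSystem N (triPos P L) where
  mono a b c d _ h2 h3 h4 h5 := hL.signMono h2 h3 h4 h5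
  spoke_spoke k k' d c h1 h2 := by
    have e1 := hL.onlyCrosser_of_spokeOnlyArc hP h1
    have e2 := hL.onlyCrosser_of_spokeOnlyArc hP h2
    obtain ⟨⟨a1, a2, a3⟩, ⟨a4, a5, -⟩, -⟩ := h1
    obtain ⟨-, ⟨b4, b5, -⟩, -⟩ := h2
    have := hP.crosser_injective e1.1 e1.2 e2.1 e2.2
    exact ((hL.mk_eq_iff (by omega) (by omega) (by omega) (by omega)).1 this).2
  spoke_arc k d c i j h1 h2 := by
    have e1 := hL.onlyCrosser_of_spokeOnlyArc hP h1
    have e2 := hL.onlyCrosser_of_arcOnlyArc hP h2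
    obtain ⟨⟨a1, a2, a3⟩, ⟨a4, a5, -⟩, -⟩ := h1
    obtain ⟨⟨b1, b2, b3⟩, -⟩ := h2
    have := hP.crosser_injective e1.1 e1.2 e2.1 e2.2
    have := ((hL.mk_eq_iff (by omega) (by omega) (by omega) (by omega)).1 this).1
    omega
  arc_arc i j i' j' k l h1 h2 := by
    have e1 := hL.onlyCrosser_of_arcOnlyArc hP h1
    have e2 := hL.onlyCrosser_of_arcOnlyArc hP h2
    obtain ⟨⟨a1, a2, a3⟩, -⟩ := h1
    obtain ⟨⟨b1, b2, b3⟩, -⟩ := h2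
    have := hP.crosser_injective e1.1 e1.2 e2.1 e2.2
    exact (hL.mk_eq_iff (by omega) (by omega) (by omega) (by omega)).1 this

end HubLabelling

/-! ### The upper bound for drawings. -/

theorem RectilinearDrawing.crossingIndex_one_le {N : ℕ}
    (D : RectilinearDrawing (⊤ : SimpleGraph (Fin (N + 1)))) :
    D.crossingIndex 1 ≤ (N + 1) / 2 + 6 + 2 * (N - 1) := by
  classical
  have hP := D.genPos
  obtain ⟨L, hL⟩ := exists_hubLabelling hP D.pos_injective
  refine le_trans ?_ (hL.spokeSystem hP).card_le
  set s := triPos D.pos L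
  set A := (SpokeSystem.oneSpokes N s).image (fun k => s(L 0, L k))
  set B := (SpokeSystem.peaks N s).image (fun k => s(L (k - 1), L (k + 1)))
  set C := (SpokeSystem.topArcs N s).image (fun p => s(L p.1, L p.2))
  have hsub : D.crossingSet 1 ⊆ ↑(A ∪ B ∪ C) := by
    intro e he
    induction e using Sym2.ind with
    | _ u v =>
    obtain ⟨huv, -⟩ := D.mem_crossingSet_one_iff.1 he
    obtain ⟨i, j, hij, hj, hl⟩ := hL.exists_labels huv
    rw [hl] at he ⊢
    obtain ⟨-, c, d, hc⟩ := D.mem_crossingSet_one_iff.1 he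
    simp only [Finset.coe_union, Set.mem_union, Finset.mem_coe, A, B, C, Finset.mem_image]
    rcases hL.cases_of_onlyCrosser hP hij hj hc with ⟨rfl, h⟩ | ⟨h1, rfl, h⟩ | h
    · exact Or.inl (Or.inl ⟨j, SpokeSystem.mem_oneSpokes.2 h, rfl⟩)
    · exact Or.inl (Or.inr ⟨i + 1, SpokeSystem.mem_peaks.2 h, rfl⟩)
    · exact Or.inr ⟨(i, j), SpokeSystem.mem_topArcs.2 h, rfl⟩
  have h1 := Set.ncard_le_ncard hsub (Finset.finite_toSet _)
  rw [Set.ncard_coe_finset] at h1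
  have h2 := Finset.card_union_le (A ∪ B) C
  have h3 := Finset.card_union_le A B
  have hA : A.card ≤ _ := Finset.card_image_le
  have hB : B.card ≤ _ := Finset.card_image_le
  have hC : C.card ≤ _ := Finset.card_image_le
  unfold RectilinearDrawing.crossingIndex
  omega

/-! ### Removing triple points by perturbation. -/

section Perturbation

variable {V : Type*}

lemma GenPos.inter_subsingleton {P : V → Plane} (hP : GenPos P) {f g : Sym2 V} (hf : ¬f.IsDiag)
    (hg : ¬g.IsDiag) (hfg : g ≠ f) : (edgeInterior P f ∩ edgeInterior P g).Subsingleton := by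
  induction f using Sym2.ind with
  | _ a b =>
  induction g using Sym2.ind with
  | _ c d =>
  intro x hx
  have h := (hP.inter_nonempty_iff hf hg hfg).1 ⟨x, hx⟩
  obtain ⟨hab, -, hac, had, hbc, hbd⟩ := GenPos.ne_of_segCross h
  exact openSegment_inter_subsingleton (hP a b c hab hac hbc) hx

lemma GenPos.injective {P : V → Plane} (hP : GenPos P) (h3 : ∀ u v : V, ∃ w, w ≠ u ∧ w ≠ v) :
    Function.Injective P := by
  intro u v huv
  by_contra hne
  obtain ⟨w, hu, hv⟩ := h3 u v
  refine hP u v w hne hu.symm hv.symm ?_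
  rw [huv]
  simp [orient]

/-- Every positively oriented triple of `P` is positively oriented in `P'`. -/
def KeepsOrient (P P' : V → Plane) : Prop :=
  ∀ u v w, 0 < orient (P u) (P v) (P w) → 0 < orient (P' u) (P' v) (P' w)

lemma KeepsOrient.genPos {P P' : V → Plane} (h : KeepsOrient P P') (hP : GenPos P) :
    GenPos P' := by
  intro u v w huv huw hvw
  rcases lt_or_gt_of_ne (hP u v w huv huw hvw) with hlt | hgt
  · have := h u w v (by rw [orient_swap]; linarith)
    rw [orient_swap] at this
    linarith
  · exact (h u v w hgt).ne'

lemma isOpen_orient_ne (a b : Plane) : IsOpen {z | orient a b z ≠ 0} := by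
  apply isOpen_ne_fun
  · unfold orient
    fun_prop
  · fun_prop

lemma dense_orient_ne {a b : Plane} (hab : a ≠ b) : Dense {z | orient a b z ≠ 0} := by
  intro z
  by_cases hz : orient a b z = 0
  swap
  · exact subset_closure hz
  set w : Plane := !₂[-(b 1 - a 1), b 0 - a 0] with hw
  have key : ∀ t : ℝ, orient a b (z + t • w)
      = orient a b z + t * ((b 0 - a 0) ^ 2 + (b 1 - a 1) ^ 2) := by
    intro t
    simp [orient, hw]
    ring
  have hpos : 0 < (b 0 - a 0) ^ 2 + (b 1 - a 1) ^ 2 := by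
    by_contra hc
    apply hab
    have e0 : (b 0 - a 0) ^ 2 = 0 := by
      nlinarith [sq_nonneg (b 0 - a 0), sq_nonneg (b 1 - a 1)]
    have e1 : (b 1 - a 1) ^ 2 = 0 := by
      nlinarith [sq_nonneg (b 0 - a 0), sq_nonneg (b 1 - a 1)]
    exact plane_ext (sub_eq_zero.1 (pow_eq_zero_iff two_ne_zero |>.1 e0)).symm
      (sub_eq_zero.1 (pow_eq_zero_iff two_ne_zero |>.1 e1)).symm
  have ht : Filter.Tendsto (fun t : ℝ => z + t • w) (nhdsWithin 0 {0}ᶜ) (nhds z) := by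
    have : Continuous (fun t : ℝ => z + t • w) := by fun_prop
    have h0 := this.tendsto 0
    simp only [zero_smul, add_zero] at h0
    exact h0.mono_left nhdsWithin_le_nhds
  refine mem_closure_of_tendsto ht ?_
  filter_upwards [self_mem_nhdsWithin] with t htne
  rw [key, hz, zero_add]
  exact mul_ne_zero htne hpos.ne'

lemma orient_eq_zero_of_mem_openSegment {a b x : Plane} (h : x ∈ openSegment ℝ a b) :
    orient b x a = 0 := by
  obtain ⟨t, -, -, h0, h1⟩ := mem_openSegment_iff.1 h
  unfold orient
  rw [h0, h1]
  ring

/-- No three edges between vertices of `S` share an interior point. -/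
def NoThreeEdges (P : V → Plane) (S : Set V) : Prop :=
  ∀ e f g : Sym2 V, (∀ x ∈ e, x ∈ S) → (∀ x ∈ f, x ∈ S) → (∀ x ∈ g, x ∈ S) → ¬e.IsDiag →
    ¬f.IsDiag → ¬g.IsDiag → e ≠ f → e ≠ g → f ≠ g →
    edgeInterior P e ∩ edgeInterior P f ∩ edgeInterior P g = ∅

open Classical in
lemma eventually_keepsOrient [Finite V] (P : V → Plane) (v : V) :
    ∀ᶠ z in nhds (P v), KeepsOrient P (Function.update P v z) := by
  unfold KeepsOrient
  rw [Filter.eventually_all]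
  intro a
  rw [Filter.eventually_all]
  intro b
  rw [Filter.eventually_all]
  intro c
  by_cases h : 0 < orient (P a) (P b) (P c)
  swap
  · exact Filter.Eventually.of_forall fun z hz => absurd hz h
  have hu : ∀ u, Continuous (fun z : Plane => Function.update P v z u) := by
    intro u
    rcases eq_or_ne u v with rfl | hne
    · simpa using continuous_id'
    · simpa [hne] using continuous_const
  have hc : Continuous (fun z : Plane => orient (Function.update P v z a)
      (Function.update P v z b) (Function.update P v z c)) := by
    have ha := hu a
    have hb := hu b
    have hc := hu c
    unfold orient
    fun_prop
  have := (hc.tendsto (P v)).eventually (lt_mem_nhds (a := 0) (by simpa using h))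
  exact this.mono fun z hz _ => hz

open Classical in
-- Orientations persist for v in a neighbourhood of its position, where v can also avoid the
-- finitely many lines through a vertex and a crossing point. Thus no edge at v meets a crossing of
-- two edges away from v. Two edges at v share no interior point, and triples away from v are
-- unchanged.
lemma exists_perturb_vertex [Finite V] (h3 : ∀ u v : V, ∃ w, w ≠ u ∧ w ≠ v) {P : V → Plane}
    (hP : GenPos P) {S : Set V} {v : V} (hS : NoThreeEdges P S) :
    ∃ P', KeepsOrient P P' ∧ NoThreeEdges P' (insert v S) := by
  by_cases hvS : v ∈ S
  · exact ⟨P, fun _ _ _ h => h, by rwa [Set.insert_eq_of_mem hvS]⟩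
  set Q : Set Plane := ⋃ f : Sym2 V, ⋃ g : Sym2 V, ⋃ (_ : ¬f.IsDiag ∧ ¬g.IsDiag ∧ g ≠ f),
    edgeInterior P f ∩ edgeInterior P g with hQ
  have hQfin : Q.Finite := by
    refine Set.finite_iUnion fun f => Set.finite_iUnion fun g => ?_
    by_cases h : ¬f.IsDiag ∧ ¬g.IsDiag ∧ g ≠ f
    · simp only [h, not_false_eq_true, ne_eq, and_self, Set.iUnion_true]
      exact (hP.inter_subsingleton h.1 h.2.1 h.2.2).finite
    · rw [Set.iUnion_eq_empty.2 fun hc => absurd hc h]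
      exact Set.finite_empty
  set T : Set (V × Plane) := {p | p.2 ∈ Q ∧ P p.1 ≠ p.2} with hT
  have hTfin : T.Finite :=
    (Set.Finite.prod (Set.finite_univ (α := V)) hQfin).subset fun p hp => ⟨trivial, hp.1⟩
  have hdense : Dense (⋂ p ∈ T, {z | orient (P p.1) p.2 z ≠ 0}) :=
    dense_biInter_of_isOpen (fun p _ => isOpen_orient_ne _ _) hTfin.countable
      fun p hp => dense_orient_ne hp.2
  obtain ⟨U, hU, hUo, hvU⟩ := eventually_nhds_iff.1 (eventually_keepsOrient P v)
  obtain ⟨z, hzU, hz⟩ := hdense.inter_open_nonempty U hUo ⟨P v, hvU⟩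
  have hk := hU z hzU
  have hP' := hk.genPos hP
  have hinj := hP'.injective h3
  refine ⟨Function.update P v z, hk, ?_⟩
  set P' := Function.update P v z with hP'def
  have same : ∀ f : Sym2 V, v ∉ f → edgeInterior P' f = edgeInterior P f := by
    intro f hf
    induction f using Sym2.ind with
    | _ c d =>
    simp only [Sym2.mem_iff, not_or] at hf
    simp [hP'def, Ne.symm hf.1, Ne.symm hf.2]
  have two : ∀ e f : Sym2 V, ¬e.IsDiag → ¬f.IsDiag → e ≠ f → v ∈ e → v ∈ f →
      edgeInterior P' e ∩ edgeInterior P' f = ∅ := by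
    rintro e f he hf hef ⟨x, rfl⟩ ⟨y, rfl⟩
    exact openSegment_inter_of_common (hP' v x y he hf (by rintro rfl; exact hef rfl))
  have one : ∀ e f g : Sym2 V, ¬e.IsDiag → ¬f.IsDiag → ¬g.IsDiag → f ≠ g → v ∈ e → v ∉ f → v ∉ g →
      edgeInterior P' e ∩ edgeInterior P' f ∩ edgeInterior P' g = ∅ := by
    rintro e f g he hf hg hfg ⟨x, rfl⟩ hvf hvg
    by_contra hne
    obtain ⟨q, ⟨hqe, hqf⟩, hqg⟩ := Set.nonempty_iff_ne_empty.2 hne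
    rw [same f hvf] at hqf
    rw [same g hvg] at hqg
    have hxv : x ≠ v := fun h => he h.symm
    have hPx : P' x = P x := by simp [hP'def, hxv]
    have hPv : P' v = z := by simp [hP'def]
    have hqQ : q ∈ Q := by
      simp only [hQ, Set.mem_iUnion]
      exact ⟨f, g, ⟨hf, hg, hfg.symm⟩, hqf, hqg⟩
    rw [edgeInterior_mk, hPx, hPv] at hqe
    have hne : P x ≠ q := by
      rintro rfl
      have := right_mem_openSegment_iff.1 hqe
      rw [← hPx, ← hPv] at this
      exact hxv (hinj this).symm
    have := Set.mem_iInter₂.1 hz (x, q) ⟨hqQ, hne⟩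
    exact this (orient_eq_zero_of_mem_openSegment hqe)
  have inS : ∀ f : Sym2 V, (∀ x ∈ f, x ∈ insert v S) → v ∉ f → ∀ x ∈ f, x ∈ S := by
    intro f hf hvf x hx
    rcases hf x hx with rfl | h
    · exact absurd hx hvf
    · exact h
  intro e f g he hf hg de df dg hef heg hfg
  by_cases ve : v ∈ e <;> by_cases vf : v ∈ f <;> by_cases vg : v ∈ g
  · rw [two e f de df hef ve vf, Set.empty_inter]
  · rw [two e f de df hef ve vf, Set.empty_inter]
  · rw [Set.inter_right_comm, two e g de dg heg ve vg, Set.empty_inter]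
  · exact one e f g de df dg hfg ve vf vg
  · rw [Set.inter_assoc, two f g df dg hfg vf vg, Set.inter_empty]
  · rw [Set.inter_comm (edgeInterior P' e)]
    exact one f e g df de dg heg vf ve vg
  · rw [Set.inter_comm, ← Set.inter_assoc]
    exact one g e f dg de df hef vg ve vf
  · rw [same e ve, same f vf, same g vg]
    exact hS e f g (inS e he ve) (inS f hf vf) (inS g hg vg) de df dg hef heg hfg

lemma exists_perturb [Finite V] (h3 : ∀ u v : V, ∃ w, w ≠ u ∧ w ≠ v) {P : V → Plane}
    (hP : GenPos P) : ∃ P', KeepsOrient P P' ∧ NoThreeEdges P' Set.univ := by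
  refine Set.Finite.induction_on (motive := fun S _ => ∃ P', KeepsOrient P P' ∧ NoThreeEdges P' S)
    _ (Set.finite_univ (α := V)) ⟨P, fun _ _ _ h => h, ?_⟩ ?_
  · intro e f g he
    induction e using Sym2.ind with
    | _ a b => exact absurd (he a (Sym2.mem_mk_left a b)) (Set.notMem_empty a)
  · rintro v S - - ⟨P', h1, h2⟩
    obtain ⟨P'', h4, h5⟩ := exists_perturb_vertex h3 (h1.genPos hP) (v := v) h2
    exact ⟨P'', fun a b c h => h4 a b c (h1 a b c h), h5⟩

/-- Points in general position can be moved to the vertices of a rectilinear drawing of the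
complete graph without changing the orientation of any triple. -/
theorem exists_drawing_of_genPos [Finite V] (h3 : ∀ u v : V, ∃ w, w ≠ u ∧ w ≠ v) {P : V → Plane}
    (hP : GenPos P) :
    ∃ D : RectilinearDrawing (⊤ : SimpleGraph V), KeepsOrient P D.pos := by
  obtain ⟨P', h1, h2⟩ := exists_perturb h3 hP
  have hP' := h1.genPos hP
  have hd : ∀ e ∈ (⊤ : SimpleGraph V).edgeSet, ¬e.IsDiag :=
    fun e he => SimpleGraph.not_isDiag_of_mem_edgeSet _ he
  exact ⟨⟨P', hP'.injective h3, genPos_iff.1 hP', fun e he f hf g hg h4 h5 h6 =>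
    h2 e f g (fun _ _ => trivial) (fun _ _ => trivial) (fun _ _ => trivial) (hd e he) (hd f hf)
      (hd g hg) h4 h5 h6⟩, h1⟩

end Perturbation

/-! ### The four-periodic point pattern and its orientations. -/

namespace FourPattern

/-- Horizontal offset inside a block of four points. -/
def offX : ℕ → ℤ
  | 0 => 0
  | 1 => 3
  | 2 => 4
  | _ => 5

/-- Vertical offset inside a block of four points. -/
def offY : ℕ → ℤ
  | 0 => 0
  | 1 => 17
  | 2 => 18
  | _ => 23

/-- Abscissa of the point `i`. -/
def ptX (i : ℕ) : ℤ := 7 * (i / 4 : ℕ) + offX (i % 4)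

/-- Ordinate of the point `i`. -/
def ptY (i : ℕ) : ℤ :=
  28 * (i / 4 : ℕ) ^ 2 + 8 * (i / 4 : ℕ) * offX (i % 4) + offY (i % 4)

/-- The points `i, j, k` for which `j` is above the chord `ik`. -/
def Above (i j k : ℕ) : Prop :=
  (j % 4 = 1 ∧ ((i + 2 = j ∧ k = j + 1) ∨ (i + 1 = j ∧ k ≤ j + 3))) ∨
    (j % 4 = 2 ∧ i + 2 = j ∧ k = j + 2) ∨ (j % 4 = 3 ∧ j ≤ i + 3 ∧ k = j + 1)

/-- The height of `j` over the line of slope `m` through `i`. -/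
def rise (m : ℤ) (i j : ℕ) : ℤ := ptY j - ptY i - m * (ptX j - ptX i)

/-- The orientation of the points `i, j, k`. -/
def det (i j k : ℕ) : ℤ := (ptX j - ptX i) * (ptY k - ptY i) - (ptX k - ptX i) * (ptY j - ptY i)

lemma ptX_block (a r : ℕ) (hr : r < 4) : ptX (4 * a + r) = 7 * a + offX r := by
  unfold ptX
  rw [show (4 * a + r) / 4 = a by omega, show (4 * a + r) % 4 = r by omega]

lemma ptY_block (a r : ℕ) (hr : r < 4) :
    ptY (4 * a + r) = 28 * a ^ 2 + 8 * a * offX r + offY r := by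
  unfold ptY
  rw [show (4 * a + r) / 4 = a by omega, show (4 * a + r) % 4 = r by omega]

lemma exists_block (i : ℕ) : ∃ a r, r < 4 ∧ i = 4 * a + r :=
  ⟨i / 4, i % 4, by omega, by omega⟩

lemma ptX_lt {i j : ℕ} (hij : i < j) : ptX i < ptX j := by
  obtain ⟨a, r, hr, rfl⟩ := exists_block i
  obtain ⟨b, t, ht, rfl⟩ := exists_block j
  rw [ptX_block _ _ hr, ptX_block _ _ ht]
  interval_cases r <;> interval_cases t <;> simp only [offX] <;> omega

lemma det_eq (m : ℤ) (i j k : ℕ) :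
    det i j k = (ptX j - ptX i) * rise m j k - (ptX k - ptX j) * rise m i j := by
  unfold det rise
  ring

/-- A line of slope m through j with i strictly above it and k not below it certifies that j is
below the chord ik. -/
lemma det_pos (m : ℤ) {i j k : ℕ} (hij : i < j) (hjk : j < k) (h1 : rise m i j < 0)
    (h2 : 0 ≤ rise m j k) : 0 < det i j k := by
  rw [det_eq m]
  have := mul_pos (sub_pos.2 (ptX_lt hjk)) (neg_pos.2 h1)
  have := mul_nonneg (sub_pos.2 (ptX_lt hij)).le h2
  linarith

/-- The bounds on the left of a point: `s` is its residue, `M` the slope, and `g` the least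
distance for which the bound is claimed. -/
lemma rise_left {b s i : ℕ} {M : ℤ} {g : ℕ}
    (hs : (s = 0 ∧ M = 0 ∧ g = 1) ∨ (s = 1 ∧ M = 2 ∧ g = 2) ∨ (s = 1 ∧ M = 1 ∧ g = 3) ∨
      (s = 1 ∧ M = 6 ∧ g = 1) ∨ (s = 2 ∧ M = 2 ∧ g = 3) ∨ (s = 2 ∧ M = 5 ∧ g = 1) ∨
      (s = 3 ∧ M = 2 ∧ g = 4) ∨ (s = 3 ∧ M = 6 ∧ g = 1))
    (hi : i + g ≤ 4 * b + s) : rise (8 * b + M) i (4 * b + s) < 0 := by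
  obtain ⟨a, r, hr, rfl⟩ := exists_block i
  obtain ⟨u, rfl⟩ : ∃ u, b = a + u := ⟨b - a, by omega⟩
  unfold rise
  rw [ptX_block _ _ hr, ptY_block _ _ hr, ptX_block _ _ (by omega), ptY_block _ _ (by omega)]
  rcases hs with ⟨rfl, rfl, rfl⟩ | ⟨rfl, rfl, rfl⟩ | ⟨rfl, rfl, rfl⟩ | ⟨rfl, rfl, rfl⟩ |
    ⟨rfl, rfl, rfl⟩ | ⟨rfl, rfl, rfl⟩ | ⟨rfl, rfl, rfl⟩ | ⟨rfl, rfl, rfl⟩ <;>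
  interval_cases r <;> rcases u with _ | w <;> simp only [offX, offY] <;>
  first
  | omega
  | (push_cast; nlinarith [sq_nonneg (w : ℤ)])
  | (push_cast; linarith)

/-- The slopes are those of `rise_left`. Block starts lie on y = 4x²/7, whose tangent at block b has
slope 8b; M adjusts this within the block. -/
lemma rise_right {b s k : ℕ} {M : ℤ} {g : ℕ}
    (hs : (s = 0 ∧ M = 0 ∧ g = 1) ∨ (s = 1 ∧ M = 2 ∧ g = 2) ∨ (s = 1 ∧ M = 1 ∧ g = 1) ∨
      (s = 1 ∧ M = 6 ∧ g = 4) ∨ (s = 2 ∧ M = 2 ∧ g = 1) ∨ (s = 2 ∧ M = 5 ∧ g = 3) ∨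
      (s = 3 ∧ M = 2 ∧ g = 1) ∨ (s = 3 ∧ M = 6 ∧ g = 2))
    (hk : 4 * b + s + g ≤ k) : 0 ≤ rise (8 * b + M) (4 * b + s) k := by
  obtain ⟨c, r, hr, rfl⟩ := exists_block k
  obtain ⟨u, rfl⟩ : ∃ u, c = b + u := ⟨c - b, by omega⟩
  unfold rise
  rw [ptX_block _ _ hr, ptY_block _ _ hr, ptX_block _ _ (by omega), ptY_block _ _ (by omega)]
  rcases hs with ⟨rfl, rfl, rfl⟩ | ⟨rfl, rfl, rfl⟩ | ⟨rfl, rfl, rfl⟩ | ⟨rfl, rfl, rfl⟩ |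
    ⟨rfl, rfl, rfl⟩ | ⟨rfl, rfl, rfl⟩ | ⟨rfl, rfl, rfl⟩ | ⟨rfl, rfl, rfl⟩ <;>
  interval_cases r <;> rcases u with _ | w <;> simp only [offX, offY] <;>
  first
  | omega
  | (push_cast; nlinarith [sq_nonneg (w : ℤ)])
  | (push_cast; linarith)
  | (have hw : (1 : ℤ) ≤ w := by omega
     push_cast; nlinarith [mul_nonneg (sub_nonneg.2 hw) (sub_nonneg.2 hw)])

lemma det_block {a b c r s t : ℕ} (hr : r < 4) (hs : s < 4) (ht : t < 4) :
    det (4 * a + r) (4 * b + s) (4 * c + t) =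
      (7 * b + offX s - (7 * a + offX r)) *
        (28 * c ^ 2 + 8 * c * offX t + offY t - (28 * a ^ 2 + 8 * a * offX r + offY r)) -
      (7 * c + offX t - (7 * a + offX r)) *
        (28 * b ^ 2 + 8 * b * offX s + offY s - (28 * a ^ 2 + 8 * a * offX r + offY r)) := by
  unfold det
  rw [ptX_block _ _ hr, ptX_block _ _ hs, ptX_block _ _ ht, ptY_block _ _ hr, ptY_block _ _ hs,
    ptY_block _ _ ht]

lemma det_neg_of_above {i j k : ℕ} (hij : i < j) (hjk : j < k) (h : Above i j k) :
    det i j k < 0 := by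
  obtain ⟨b, s, hs, rfl⟩ := exists_block j
  rcases h with ⟨h1, ⟨h2, h3⟩ | ⟨h2, h3⟩⟩ | ⟨h1, h2, h3⟩ | ⟨h1, h2, h3⟩
  · obtain rfl : s = 1 := by omega
    obtain ⟨a, rfl⟩ : ∃ a, b = a + 1 := ⟨b - 1, by omega⟩
    obtain rfl : i = 4 * a + 3 := by omega
    obtain rfl : k = 4 * (a + 1) + 2 := by omega
    rw [det_block (by omega) (by omega) (by omega)]
    simp only [offX, offY]
    push_cast
    linarith
  · obtain rfl : s = 1 := by omega
    obtain rfl : i = 4 * b + 0 := by omega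
    rcases (by omega : k = 4 * b + 2 ∨ k = 4 * b + 3 ∨ k = 4 * (b + 1) + 0) with rfl | rfl | rfl <;>
    · rw [det_block (by omega) (by omega) (by omega)]
      simp only [offX, offY]
      push_cast
      linarith
  · obtain rfl : s = 2 := by omega
    obtain rfl : i = 4 * b + 0 := by omega
    obtain rfl : k = 4 * (b + 1) + 0 := by omega
    rw [det_block (by omega) (by omega) (by omega)]
    simp only [offX, offY]
    push_cast
    linarith
  · obtain rfl : s = 3 := by omega
    obtain rfl : k = 4 * (b + 1) + 0 := by omega
    rcases (by omega : i = 4 * b + 0 ∨ i = 4 * b + 1 ∨ i = 4 * b + 2) with rfl | rfl | rfl <;>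
    · rw [det_block (by omega) (by omega) (by omega)]
      simp only [offX, offY]
      push_cast
      linarith

/-- Each residue of j needs up to three certifying slopes, according to how near i and k are. Two
rises at adjacent points fall outside the general bounds and are computed directly. -/
lemma det_pos_of_not_above {i j k : ℕ} (hij : i < j) (hjk : j < k) (h : ¬Above i j k) :
    0 < det i j k := by
  obtain ⟨b, s, hs, rfl⟩ := exists_block j
  unfold Above at h
  interval_cases s
  · exact det_pos (8 * b + 0) hij hjk (rise_left (g := 1) (by simp) (by omega))
      (rise_right (g := 1) (by simp) (by omega))
  · by_cases h2 : i + 2 ≤ 4 * b + 1 ∧ 4 * b + 3 ≤ k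
    · exact det_pos (8 * b + 2) hij hjk (rise_left (g := 2) (by simp) (by omega))
        (rise_right (g := 2) (by simp) (by omega))
    by_cases h1 : i + 3 ≤ 4 * b + 1
    · exact det_pos (8 * b + 1) hij hjk (rise_left (g := 3) (by simp) (by omega))
        (rise_right (g := 1) (by simp) (by omega))
    · exact det_pos (8 * b + 6) hij hjk (rise_left (g := 1) (by simp) (by omega))
        (rise_right (g := 4) (by simp) (by omega))
  · by_cases h2 : i + 2 = 4 * b + 2
    · obtain rfl : i = 4 * b + 0 := by omega
      refine det_pos (8 * b + 5) hij hjk (rise_left (g := 1) (by simp) (by omega)) ?_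
      by_cases h3 : k = 4 * b + 3
      · subst h3
        unfold rise
        rw [ptX_block _ _ (by omega), ptY_block _ _ (by omega), ptX_block _ _ (by omega),
          ptY_block _ _ (by omega)]
        simp only [offX, offY]
        linarith
      · exact rise_right (g := 3) (by simp) (by omega)
    · by_cases h1 : i + 1 = 4 * b + 2
      · obtain rfl : i = 4 * b + 1 := by omega
        refine det_pos (8 * b + 2) hij hjk ?_ (rise_right (g := 1) (by simp) (by omega))
        unfold rise
        rw [ptX_block _ _ (by omega), ptY_block _ _ (by omega), ptX_block _ _ (by omega),
          ptY_block _ _ (by omega)]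
        simp only [offX, offY]
        linarith
      · exact det_pos (8 * b + 2) hij hjk (rise_left (g := 3) (by simp) (by omega))
          (rise_right (g := 1) (by simp) (by omega))
  · by_cases h1 : i + 4 ≤ 4 * b + 3
    · exact det_pos (8 * b + 2) hij hjk (rise_left (g := 4) (by simp) (by omega))
        (rise_right (g := 1) (by simp) (by omega))
    · exact det_pos (8 * b + 6) hij hjk (rise_left (g := 1) (by simp) (by omega))
        (rise_right (g := 2) (by simp) (by omega))

lemma det_neg_iff {i j k : ℕ} (hij : i < j) (hjk : j < k) : det i j k < 0 ↔ Above i j k := by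
  constructor
  · intro h
    by_contra hn
    exact absurd (det_pos_of_not_above hij hjk hn) (by omega)
  · exact det_neg_of_above hij hjk

lemma det_ne_zero {i j k : ℕ} (hij : i < j) (hjk : j < k) : det i j k ≠ 0 := by
  by_cases h : Above i j k
  · exact (det_neg_of_above hij hjk h).ne
  · exact (det_pos_of_not_above hij hjk h).ne'

end FourPattern

/-! ### Once-crossed edges of the pattern. -/

namespace FourPattern

variable {N : ℕ} {s : ℕ → ℕ → ℕ → Prop}
  (hs : ∀ i j k, 1 ≤ i → i < j → j < k → k ≤ N → (s i j k ↔ Above i j k))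
include hs

/-- In each block of four, away from the ends, this gives three edges; `arcOnlySpoke_even` gives two
and `spokeOnlyArc_two` one. These six are listed by `onceCrossed`. -/
lemma arcOnlyArc_path {t : ℕ} (h1 : 1 ≤ t) (h2 : t + 3 ≤ N) (h3 : (t + 1) % 4 ≠ 3) :
    ArcOnlyArc N s (t + 1) (t + 2) t (t + 3) := by
  refine ⟨⟨by omega, by omega, by omega⟩, ⟨by omega, by omega, by omega⟩,
    Or.inr (Or.inr (Or.inr ⟨by omega, by omega, ?_⟩)), fun m hm => ?_, ?_⟩
  · rw [hs _ _ _ (by omega) (by omega) (by omega) (by omega),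
      hs _ _ _ (by omega) (by omega) (by omega) (by omega)]
    unfold Above
    omega
  · have h4 := hm.1
    have h5 := hm.2.1
    omega
  · rintro x y ⟨a1, a2, a3⟩ hX
    obtain ⟨b1, b2, b3⟩ := SpokeSystem.short_arc_cross hX a2
    rw [hs _ _ _ (by omega) (by omega) (by omega) (by omega),
      hs _ _ _ (by omega) (by omega) (by omega) (by omega)] at b3
    unfold Above at b3
    omega

lemma arcOnlySpoke_even {t : ℕ} (h1 : 1 ≤ t) (h2 : t + 2 ≤ N) (h3 : t % 2 = 0) :
    ArcOnlySpoke N s t (t + 2) (t + 1) := by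
  have h0 : s t (t + 1) (t + 2) := by
    rw [hs _ _ _ (by omega) (by omega) (by omega) (by omega)]
    unfold Above
    omega
  refine ⟨⟨by omega, by omega, by omega⟩, ⟨by omega, by omega, h0⟩, fun m hm => ?_, ?_⟩
  · have h4 := hm.1
    have h5 := hm.2.1
    omega
  · rintro x y ⟨a1, a2, a3⟩ (⟨b1, b2, b3, b⟩ | ⟨b1, b2, b3, b⟩ | ⟨b1, b2, b⟩ | ⟨b1, b2, b⟩)
    · rw [hs _ _ _ (by omega) (by omega) (by omega) (by omega),
        hs _ _ _ (by omega) (by omega) (by omega) (by omega)] at b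
      unfold Above at b
      omega
    · rw [hs _ _ _ (by omega) (by omega) (by omega) (by omega),
        hs _ _ _ (by omega) (by omega) (by omega) (by omega)] at b
      unfold Above at b
      omega
    · omega
    · rw [hs _ _ _ (by omega) (by omega) (by omega) (by omega),
        hs _ _ _ (by omega) (by omega) (by omega) (by omega)] at b
      unfold Above at b
      omega

lemma spokeOnlyArc_two {t : ℕ} (h1 : 1 ≤ t) (h2 : t + 4 ≤ N) (h3 : (t + 2) % 4 = 2) :
    SpokeOnlyArc N s (t + 2) t (t + 4) := by
  refine ⟨⟨by omega, by omega, by omega⟩, ⟨by omega, by omega, ?_⟩, ?_⟩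
  · rw [hs _ _ _ (by omega) (by omega) (by omega) (by omega)]
    unfold Above
    omega
  · rintro x y ⟨a1, a2, a3⟩ ⟨b1, b2, b⟩
    rw [hs _ _ _ (by omega) (by omega) (by omega) (by omega)] at b
    unfold Above at b
    omega

end FourPattern

/-! ### Realising the pattern with a hub. -/

namespace FourPattern

/-- The points of the pattern, with the hub `(0, Y)` as the vertex `0`. -/
noncomputable def place (N : ℕ) (Y : ℤ) (v : Fin (N + 1)) : Plane :=
  -- Negating the ordinates turns "above the chord" into "beyond the chord as seen from the hub".
  if (v : ℕ) = 0 then !₂[0, (Y : ℝ)] else !₂[(ptX v : ℝ), -(ptY v : ℝ)]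

lemma orient_place {N : ℕ} {Y : ℤ} {u v w : Fin (N + 1)} (hu : (u : ℕ) ≠ 0) (hv : (v : ℕ) ≠ 0)
    (hw : (w : ℕ) ≠ 0) :
    orient (place N Y u) (place N Y v) (place N Y w) = -(det u v w : ℝ) := by
  simp [orient, place, hu, hv, hw, det]
  ring

lemma orient_place_zero {N : ℕ} {Y : ℤ} {u v w : Fin (N + 1)} (hu : (u : ℕ) = 0) (hv : (v : ℕ) ≠ 0)
    (hw : (w : ℕ) ≠ 0) :
    orient (place N Y u) (place N Y v) (place N Y w) =
      ((Y * (ptX w - ptX v) - (ptX v * ptY w - ptX w * ptY v) : ℤ) : ℝ) := by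
  simp [orient, place, hu, hv, hw]
  ring

/-- From a sufficiently high hub, the angular order of the points is the order of their abscissas.
-/
lemma exists_height (N : ℕ) : ∃ Y : ℤ, ∀ i j, 1 ≤ i → i < j → j ≤ N →
    0 < Y * (ptX j - ptX i) - (ptX i * ptY j - ptX j * ptY i) := by
  obtain ⟨M, hM⟩ := Finset.exists_le ((Finset.range (N + 1) ×ˢ Finset.range (N + 1)).image
    (fun p : ℕ × ℕ => ptX p.1 * ptY p.2 - ptX p.2 * ptY p.1))
  refine ⟨max M 0 + 1, fun i j h1 h2 h3 => ?_⟩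
  have h4 : ptX i * ptY j - ptX j * ptY i ≤ M := hM _ (Finset.mem_image.2 ⟨(i, j), by
    simp only [Finset.mem_product, Finset.mem_range]; omega, rfl⟩)
  have h5 := ptX_lt h2
  have h6 : 0 ≤ max M 0 := le_max_right _ _
  have h7 : M ≤ max M 0 := le_max_left _ _
  nlinarith

lemma genPos_of_lt {n : ℕ} {P : Fin n → Plane}
    (h : ∀ u v w, u < v → v < w → orient (P u) (P v) (P w) ≠ 0) : GenPos P := by
  have swap : ∀ a b c, orient a b c ≠ 0 → orient a c b ≠ 0 := by
    intro a b c hab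
    rw [orient_swap]
    exact neg_ne_zero.2 hab
  have rot : ∀ a b c, orient a b c ≠ 0 → orient b c a ≠ 0 := by
    intro a b c hab
    rwa [orient_rotate]
  intro u v w huv huw hvw
  rcases lt_or_gt_of_ne huv with h1 | h1 <;> rcases lt_or_gt_of_ne huw with h2 | h2 <;>
    rcases lt_or_gt_of_ne hvw with h3 | h3
  · exact h _ _ _ h1 h3
  · exact swap _ _ _ (h _ _ _ h2 h3)
  · exact absurd (h1.trans h3) h2.not_gt
  · exact rot _ _ _ (h _ _ _ h2 h1)
  · exact rot _ _ _ (rot _ _ _ (swap _ _ _ (h _ _ _ h1 h2)))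
  · exact absurd (h2.trans h3) h1.not_gt
  · exact rot _ _ _ (rot _ _ _ (h _ _ _ h3 h2))
  · exact swap _ _ _ (rot _ _ _ (rot _ _ _ (h _ _ _ h3 h1)))

lemma exists_genPos (N : ℕ) : ∃ P : Fin (N + 1) → Plane, GenPos P ∧
    (∀ u v w : Fin (N + 1), (u : ℕ) = 0 → (v : ℕ) ≠ 0 → v < w → 0 < orient (P u) (P v) (P w)) ∧
    (∀ u v w : Fin (N + 1), (u : ℕ) ≠ 0 → u < v → v < w →
      (0 < orient (P u) (P v) (P w) ↔ Above u v w)) := by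
  obtain ⟨Y, hY⟩ := exists_height N
  have h0 : ∀ u v w : Fin (N + 1), (u : ℕ) = 0 → (v : ℕ) ≠ 0 → v < w →
      0 < orient (place N Y u) (place N Y v) (place N Y w) := by
    intro u v w hu hv hvw
    rw [Fin.lt_def] at hvw
    rw [orient_place_zero hu hv (by omega)]
    exact_mod_cast hY v w (by omega) hvw (by omega)
  refine ⟨place N Y, genPos_of_lt fun u v w huv hvw => ?_, h0, fun u v w hu huv hvw => ?_⟩
  · rw [Fin.lt_def] at huv
    by_cases hu : (u : ℕ) = 0
    · exact (h0 u v w hu (by omega) hvw).ne'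
    · rw [Fin.lt_def] at hvw
      rw [orient_place hu (by omega) (by omega)]
      exact neg_ne_zero.2 (by exact_mod_cast det_ne_zero huv hvw)
  · rw [Fin.lt_def] at huv hvw
    rw [orient_place hu (by omega) (by omega), ← det_neg_iff huv hvw, neg_pos]
    exact_mod_cast Iff.rfl

/-- The vertices of the `m`-th edge that is crossed exactly once. -/
def onceCrossed (m : ℕ) : ℕ × ℕ :=
  if m % 6 = 0 then (4 * (m / 6) + 2, 4 * (m / 6) + 3)
  else if m % 6 = 1 then (4 * (m / 6) + 2, 4 * (m / 6) + 4)
  else if m % 6 = 2 then (4 * (m / 6) + 4, 4 * (m / 6) + 5)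
  else if m % 6 = 3 then (4 * (m / 6) + 4, 4 * (m / 6) + 6)
  else if m % 6 = 4 then (4 * (m / 6) + 5, 4 * (m / 6) + 6)
  else (0, 4 * (m / 6) + 6)

lemma onceCrossed_injective {m m' : ℕ} (h1 : (onceCrossed m).1 = (onceCrossed m').1)
    (h2 : (onceCrossed m).2 = (onceCrossed m').2) : m = m' := by
  unfold onceCrossed at h1 h2
  split_ifs at h1 h2 <;> simp only at h1 h2 <;> omega

end FourPattern

/-! ### The lower bound and the conclusion. -/

theorem exists_drawing_le_crossingIndex {N : ℕ} (hN : 7 ≤ N) :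
    ∃ D : RectilinearDrawing (⊤ : SimpleGraph (Fin (N + 1))),
      (3 * N + 4) / 2 - 7 ≤ D.crossingIndex 1 := by
  classical
  obtain ⟨P, hP, h0, habove⟩ := FourPattern.exists_genPos N
  obtain ⟨D, hD⟩ := exists_drawing_of_genPos (V := Fin (N + 1)) (by
    intro u v
    obtain ⟨w, hw⟩ := Finset.exists_mem_notMem_of_card_lt_card (s := {u, v})
      (t := Finset.univ) (by
        rw [Finset.card_univ, Fintype.card_fin]
        have := Finset.card_le_two (a := u) (b := v)
        omega)
    simp only [Finset.mem_univ, Finset.mem_insert, Finset.mem_singleton, true_and, not_or] at hw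
    exact ⟨w, hw⟩) hP
  have hP' := D.genPos
  set L : ℕ → Fin (N + 1) := Fin.ofNat (N + 1) with hLdef
  have hval : ∀ i, i ≤ N → ((L i : Fin (N + 1)) : ℕ) = i := by
    intro i hi
    simp only [hLdef, Fin.val_ofNat]
    exact Nat.mod_eq_of_lt (by omega)
  have hlt : ∀ i j, i < j → j ≤ N → L i < L j := by
    intro i j hij hj
    rw [Fin.lt_def, hval i (by omega), hval j hj]
    exact hij
  have hL : HubLabelling D.pos L := by
    refine ⟨fun i j hi hj h => ?_, fun v => ⟨v, by omega, Fin.ext (hval v (by omega))⟩,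
      fun i j h1 h2 h3 => hD _ _ _ (h0 _ _ _ (hval 0 (by omega)) ?_ (hlt i j h2 h3))⟩
    · rw [← hval i hi, ← hval j hj, h]
    · rw [hval i (by omega)]
      omega
  have hs : ∀ i j k, 1 ≤ i → i < j → j < k → k ≤ N →
      (triPos D.pos L i j k ↔ FourPattern.Above i j k) := by
    intro i j k h1 h2 h3 h4
    have h := habove (L i) (L j) (L k) (by rw [hval i (by omega)]; omega) (hlt i j h2 (by omega))
      (hlt j k h3 h4)
    rw [hval i (by omega), hval j (by omega), hval k h4] at h
    rw [← h]
    -- `KeepsOrient` concerns positive triples only; a negative one is handled by exchanging its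
    -- last two points.
    refine ⟨fun hp => ?_, hD _ _ _⟩
    by_contra hc
    have hne := hP (L i) (L j) (L k) (hlt i j h2 (by omega)).ne (hlt i k (by omega) h4).ne
      (hlt j k h3 h4).ne
    have := hD (L i) (L k) (L j) (by
      rw [orient_swap]
      have := lt_of_le_of_ne (not_lt.1 hc) hne
      linarith)
    rw [orient_swap] at this
    have hp' : 0 < orient (D.pos (L i)) (D.pos (L j)) (D.pos (L k)) := hp
    linarith
  refine ⟨D, ?_⟩
  -- For n = N + 1 the quotient is ⌈3n/2⌉. Subtracting 7 keeps every listed edge, and the arcs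
  -- needed to cross it, within the labels up to N.
  set K := (3 * N + 4) / 2 - 7 with hK
  have hmem : ∀ {i j k l : ℕ}, i < j → j ≤ N → OnlyCrosser D.pos (L i) (L j) (L k) (L l) →
      s(L i, L j) ∈ D.crossingSet 1 := by
    intro i j k l hij hj h
    exact D.mem_crossingSet_one_iff.2 ⟨(hlt i j hij hj).ne, _, _, h⟩
  have path : ∀ t, 1 ≤ t → t + 3 ≤ N → (t + 1) % 4 ≠ 3 →
      s(L (t + 1), L (t + 2)) ∈ D.crossingSet 1 := fun t h1 h2 h3 =>
    hmem (by omega) (by omega)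
      (hL.onlyCrosser_of_arcOnlyArc hP' (FourPattern.arcOnlyArc_path hs h1 h2 h3))
  have even : ∀ t, 1 ≤ t → t + 2 ≤ N → t % 2 = 0 →
      s(L t, L (t + 2)) ∈ D.crossingSet 1 := fun t h1 h2 h3 =>
    hmem (by omega) (by omega)
      (hL.onlyCrosser_of_arcOnlySpoke hP' (FourPattern.arcOnlySpoke_even hs h1 h2 h3))
  have spoke : ∀ t, 1 ≤ t → t + 4 ≤ N → (t + 2) % 4 = 2 →
      s(L 0, L (t + 2)) ∈ D.crossingSet 1 := fun t h1 h2 h3 =>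
    hmem (by omega) (by omega)
      (hL.onlyCrosser_of_spokeOnlyArc hP' (FourPattern.spokeOnlyArc_two hs h1 h2 h3))
  have bound : ∀ m < K, (FourPattern.onceCrossed m).1 < (FourPattern.onceCrossed m).2 ∧
      (FourPattern.onceCrossed m).2 ≤ N := by
    intro m hm
    unfold FourPattern.onceCrossed
    split_ifs <;> simp only <;> omega
  have once : ∀ m < K, s(L (FourPattern.onceCrossed m).1, L (FourPattern.onceCrossed m).2)
      ∈ D.crossingSet 1 := by
    intro m hm
    unfold FourPattern.onceCrossed
    split_ifs
    · exact path (4 * (m / 6) + 1) (by omega) (by omega) (by omega)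
    · exact even (4 * (m / 6) + 2) (by omega) (by omega) (by omega)
    · exact path (4 * (m / 6) + 3) (by omega) (by omega) (by omega)
    · exact even (4 * (m / 6) + 4) (by omega) (by omega) (by omega)
    · exact path (4 * (m / 6) + 4) (by omega) (by omega) (by omega)
    · exact spoke (4 * (m / 6) + 4) (by omega) (by omega) (by omega)
  have hcard : ((Finset.range K).image
      (fun m => s(L (FourPattern.onceCrossed m).1, L (FourPattern.onceCrossed m).2))).card = K := by
    rw [Finset.card_image_of_injOn, Finset.card_range]
    intro m hm m' hm' h
    simp only [Finset.coe_range, Set.mem_Iio] at hm hm'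
    obtain ⟨b1, b2⟩ := bound m hm
    obtain ⟨b3, b4⟩ := bound m' hm'
    obtain ⟨e1, e2⟩ := (hL.mk_eq_iff b1 b2 b3 b4).1 h
    exact FourPattern.onceCrossed_injective e1 e2
  rw [← hcard, ← Set.ncard_coe_finset]
  refine Set.ncard_le_ncard ?_ (Set.toFinite _)
  intro e he
  simp only [Finset.coe_image, Set.mem_image, Finset.coe_range, Set.mem_Iio] at he
  obtain ⟨m, hm, rfl⟩ := he
  exact once m hm

lemma ceil_three_halves {n c : ℕ} (h1 : 2 * c ≤ 3 * n + 1) (h2 : 3 * n ≤ 2 * c) :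
    ⌈3 * (n : ℚ) / 2⌉ = c := by
  rw [Int.ceil_eq_iff]
  have h1' : 2 * (c : ℚ) ≤ 3 * n + 1 := by exact_mod_cast h1
  have h2' : 3 * (n : ℚ) ≤ 2 * c := by exact_mod_cast h2
  push_cast
  constructor <;> linarith

lemma floor_pred_half {n c : ℕ} (h1 : 2 * c + 1 ≤ n) (h2 : n ≤ 2 * c + 2) :
    ⌊((n : ℚ) - 1) / 2⌋ = c := by
  rw [Int.floor_eq_iff]
  have h1' : 2 * (c : ℚ) + 1 ≤ n := by exact_mod_cast h1
  have h2' : (n : ℚ) ≤ 2 * c + 2 := by exact_mod_cast h2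
  push_cast
  constructor <;> linarith

theorem mainTheorem6 (n : ℕ) (hn : 8 ≤ n) :
    IsGreatest (rectilinearCrossingIndices (⊤ : SimpleGraph (Fin n)) 1)
      (maxRectilinearCrossingIndex (⊤ : SimpleGraph (Fin n)) 1) ∧
    ⌈3 * (n : ℚ) / 2⌉ - 7 ≤ (maxRectilinearCrossingIndex (⊤ : SimpleGraph (Fin n)) 1 : ℤ) ∧
    (maxRectilinearCrossingIndex (⊤ : SimpleGraph (Fin n)) 1 : ℤ) ≤
      2 * (n : ℤ) + ⌊((n : ℚ) - 1) / 2⌋ + 7 := by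
  obtain ⟨N, rfl⟩ : ∃ N, n = N + 1 := ⟨n - 1, by omega⟩
  obtain ⟨D, hD⟩ := exists_drawing_le_crossingIndex (N := N) (by omega)
  have hbdd : BddAbove (rectilinearCrossingIndices (⊤ : SimpleGraph (Fin (N + 1))) 1) := by
    refine ⟨(N + 1) / 2 + 6 + 2 * (N - 1), ?_⟩
    rintro m ⟨D, rfl⟩
    exact D.crossingIndex_one_le
  have hmem : D.crossingIndex 1 ∈ rectilinearCrossingIndices (⊤ : SimpleGraph (Fin (N + 1))) 1 :=
    ⟨D, rfl⟩
  have hgr : IsGreatest (rectilinearCrossingIndices (⊤ : SimpleGraph (Fin (N + 1))) 1)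
      (maxRectilinearCrossingIndex (⊤ : SimpleGraph (Fin (N + 1))) 1) :=
    ⟨Nat.sSup_mem ⟨_, hmem⟩ hbdd, fun m hm => le_csSup hbdd hm⟩
  have hlow := hgr.2 hmem
  obtain ⟨D', hD'⟩ := hgr.1
  have hup := D'.crossingIndex_one_le
  rw [hD'] at hup
  -- In terms of n the proved upper bound is 2n + ⌊n/2⌋ + 2, at least four below the claimed one.
  rw [ceil_three_halves (n := N + 1) (c := (3 * N + 4) / 2) (by omega) (by omega),
    floor_pred_half (n := N + 1) (c := N / 2) (by omega) (by omega)]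
  refine ⟨hgr, ?_, ?_⟩ <;> omega
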